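/- All graphs are finite and simple, and "subgraph" means induced subgraph; a graph $H$ embeds in $G$ if $H$ is isomorphic to an induced subgraph of $G$. A graph $G$ is C-HH if every homomorphism from a connected induced subgraph of $G$ into $G$ extends to a homomorphism $G\to G$. Definitions. For $n\ge 2$, a connected graph is $K_n$-treelike if it is built from copies of $K_n$ that cover all its vertices and edges, such that two distinct copies share at most one vertex and every induced cycle is contained in a single copy. The two-squares graph is the $6$-cycle with one long diagonal (joining two opposite vertices). A square is an induced $4$-cycle. $\overline{L(K_{2,n})}$ denotes the bipartite complement of a perfect matching: the graph with vertices $x_1,\dots,x_n,y_1,\dots,y_n$ whose edges are exactly the pairs $x_iy_j$ with $i\neq j$. A vertex $v$ is a common neighbour of a set $A$ of vertices if it is adjacent to every element of $A$. A $\mathrm{PCM}(n)$ graph is a connected bipartite graph with parts $X,Y$ such that $2\le |X|\le |Y|=n$ and such that there is an injection $X\to Y$, $x\mapsto y_x$, with $x$ not adjacent to $y_x$ for every $x\in X$. A graph is $\mathrm{PCM}(n)$-free if no $\mathrm{PCM}(n)$ graph embeds in it. Theorem. A finite graph $G$ is C-HH if and only if it is the disjoint union of connected C-HH graphs $G_1,\dots,G_k$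 (its connected components) such that one of the following holds: (a) $G$ is an independent set (it has no edges); (b) there is an $n\ge 3$ such that every $G_i$ is $K_n$-treelike; (c) every $G_i$ has at least two vertices, all induced cycles of $G_i$ are squares (there may be none), and the two-squares graph does not embed in $G_i$; (d) every $G_i$ is bipartite and each of its two parts has a common neighbour; (e) there is an $n\ge 3$ such that at least one $G_i$ is isomorphic to $\overline{L(K_{2,n})}$, and every $G_i$ not isomorphic to $\overline{L(K_{2,n})}$ is a $\mathrm{PCM}(n)$-free bipartite graph each of whose two parts has a common neighbour. -/

import Mathlib

namespace CHHGraph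

universe u

/-- `G` is C-HH (connected-homomorphism-homogeneous): every homomorphism from a finite connected
induced subgraph of `G` into `G` extends to a homomorphism from `G` to `G`. -/
def IsCHH {V : Type u} (G : SimpleGraph V) : Prop :=
  ∀ A : Set V, A.Finite → (G.induce A).Connected →
    ∀ φ : G.induce A →g G, ∃ ψ : G →g G, ∀ a : A, ψ a = φ a

/-- `X`, `Y` are the parts of a bipartition of `G`: together they partition the vertex set, and
every edge joins a vertex of `X` to a vertex of `Y`. -/
def IsBipartition {V : Type u} (G : SimpleGraph V) (X Y : Set V) : Prop :=
  G.IsBipartiteWith X Y ∧ X ∪ Y = Set.univ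

/-- `G` is `K_n`-treelike (`n ≥ 2`): it is connected and made up of copies of `K_n` (the members of
`𝒞`, called components) that cover all vertices and all edges; two distinct components are
identified in at most one vertex; and no new cycles arise, i.e. each induced cycle of `G` lies in a
single component. -/
def IsTreelike {V : Type u} (n : ℕ) (G : SimpleGraph V) : Prop :=
  2 ≤ n ∧ G.Connected ∧ ∃ 𝒞 : Set (Finset V),
    (∀ C ∈ 𝒞, G.IsNClique n C) ∧
    (∀ v, ∃ C ∈ 𝒞, v ∈ C) ∧
    (∀ u v, G.Adj u v → ∃ C ∈ 𝒞, u ∈ C ∧ v ∈ C) ∧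
    (∀ C ∈ 𝒞, ∀ D ∈ 𝒞, C ≠ D → ((C : Set V) ∩ (D : Set V)).Subsingleton) ∧
    (∀ k, 3 ≤ k → ∀ f : SimpleGraph.cycleGraph k ↪g G, ∃ C ∈ 𝒞, ∀ i, f i ∈ C)

/-- All induced cycles of `G` are squares (vacuously true if there are none). -/
def AllInducedCyclesSquares {V : Type u} (G : SimpleGraph V) : Prop :=
  ∀ k, 3 ≤ k → (SimpleGraph.cycleGraph k).IsIndContained G → k = 4

/-- The two-squares graph: the 6-cycle with one (long) diagonal. -/
def twoSquares : SimpleGraph (Fin 6) :=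
  SimpleGraph.cycleGraph 6 ⊔ SimpleGraph.edge 0 3

/-- `G` is bipartite and each of its two parts has a common neighbour. -/
def PartsHaveCommonNeighbour {V : Type u} (G : SimpleGraph V) : Prop :=
  ∃ X Y : Set V, IsBipartition G X Y ∧
    (∃ v, ∀ x ∈ X, G.Adj v x) ∧ (∃ v, ∀ y ∈ Y, G.Adj v y)

/-- The bipartite complement of a perfect matching (the complement of the line graph of
`K_{2,n}`): parts `x_1, …, x_n` and `y_1, …, y_n`, with `x_i` adjacent to `y_j` iff `i ≠ j`. -/
def matchingComplement (n : ℕ) : SimpleGraph (Fin n ⊕ Fin n) where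
  Adj
    | .inl i, .inr j => i ≠ j
    | .inr i, .inl j => i ≠ j
    | _, _ => False
  symm := ⟨by rintro (i | i) (j | j) h <;> first | exact h.elim | exact Ne.symm h⟩
  loopless := ⟨by rintro (i | i) h <;> exact h⟩

/-- `G` is a `PCM(n)` graph: a finite connected bipartite graph with parts `X`, `Y`,
`2 ≤ |X| ≤ |Y| = n`, having a perfect complement matching `x ↦ y_x`. (Finiteness of the parts is
forced, since `Set.ncard` of an infinite set is `0`.) -/
def IsPCM {V : Type u} (n : ℕ) (G : SimpleGraph V) : Prop :=
  G.Connected ∧ ∃ X Y : Set V, IsBipartition G X Y ∧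
    2 ≤ X.ncard ∧ X.ncard ≤ Y.ncard ∧ Y.ncard = n ∧
    ∃ f : V → V, Set.MapsTo f X Y ∧ Set.InjOn f X ∧ ∀ x ∈ X, ¬ G.Adj x (f x)

/-- `G` is `PCM(n)`-free: no induced subgraph of `G` is a `PCM(n)` graph. -/
def IsPCMFree {V : Type u} (n : ℕ) (G : SimpleGraph V) : Prop :=
  ∀ S : Set V, ¬ IsPCM n (G.induce S)

end CHHGraph

namespace CHHGraph

universe u v w

/-! A connected subgraph and its homomorphic image each lie in one component, so C-HH means that
extension holds for every ordered pair of components (`isCHH_iff_extends_components`). By finiteness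
it is enough to extend over one new vertex v adjacent to the domain A (`extends_of_exists_adj`):
some vertex must be adjacent to the images of all neighbours of v in A.

Sufficiency. In treelike graphs these neighbours form a clique of fewer than n vertices, whose image
lies in a copy of K_n with a vertex to spare. In case (c), two or more such neighbours have a common
neighbour z in A, and the image of z serves. In the bipartite cases the images of the neighbours lie
in one part. A common neighbour of that part settles (d). In a crown (bipartite complement of a
perfect matching) the step fails only if the images fill the part, and then `exists_isPCM` finds a
PCM(n) graph in the source.

Necessity. Each forbidden configuration yields a homomorphism whose extension would need an
impossible vertex. If some component is not bipartite, folding a subgraph onto an edge produces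
triangles, and folding around a maximum clique excludes all induced cycles but triangles
(`Extends.isTreelike`). If all components are bipartite and one violates (c), an induced path whose
ends have a common neighbour can be wrapped along walks, so ends of walks of length four have common
neighbours in every component. Then any two vertices of one part have a common neighbour, and a
minimal set without one spans a crown; `IsCrown.nonempty_iso` shows that the crown is the whole
component. Finally, a PCM(n) graph maps to a crown so as to cover a part (`not_isPCM_of_extends`).
This gives the PCM(n)-freeness in (e) and, with `exists_isPCM`, makes all crowns equal in size. -/

/-- Every homomorphism from a connected induced subgraph of `H` into `K` extends to `H`. -/
def Extends {V : Type u} {W : Type v} (H : SimpleGraph V) (K : SimpleGraph W) : Prop :=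
  ∀ A : Set V, (H.induce A).Connected →
    ∀ φ : H.induce A →g K, ∃ ψ : H →g K, ∀ a : A, ψ a = φ a

/-- The function `φ` is a homomorphism on the subgraph of `H` induced by `A`. -/
def HomOn {V : Type u} {W : Type v} (H : SimpleGraph V) (K : SimpleGraph W) (A : Set V)
    (φ : V → W) : Prop :=
  ∀ a ∈ A, ∀ b ∈ A, H.Adj a b → K.Adj (φ a) (φ b)

/-! ### Connected induced subgraphs and geodesics -/

section Connectedness

variable {V : Type u} {G : SimpleGraph V}

theorem connected_induce_singleton (a : V) : (G.induce {a}).Connected := by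
  rw [SimpleGraph.connected_iff]
  refine ⟨?_, ⟨⟨a, rfl⟩⟩⟩
  rintro ⟨x, rfl⟩ ⟨y, rfl⟩
  exact SimpleGraph.Reachable.refl _

theorem reachable_induce_mono {A B : Set V} (h : A ⊆ B) {x y : V} (hx : x ∈ A) (hy : y ∈ A)
    (hr : (G.induce A).Reachable ⟨x, hx⟩ ⟨y, hy⟩) :
    (G.induce B).Reachable ⟨x, h hx⟩ ⟨y, h hy⟩ :=
  hr.map (SimpleGraph.induceHomOfLE G h).toHom

theorem connected_induce_union {A B : Set V} (hA : (G.induce A).Connected)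
    (hB : ∀ b ∈ B, ∃ a ∈ A, G.Adj b a) : (G.induce (A ∪ B)).Connected := by
  obtain ⟨⟨o, ho⟩⟩ := hA.nonempty
  have key : ∀ x (hx : x ∈ A ∪ B),
      (G.induce (A ∪ B)).Reachable ⟨x, hx⟩ ⟨o, Or.inl ho⟩ := by
    intro x hx
    have hAr : ∀ a (ha : a ∈ A),
        (G.induce (A ∪ B)).Reachable ⟨a, Or.inl ha⟩ ⟨o, Or.inl ho⟩ := fun a ha =>
      reachable_induce_mono Set.subset_union_left ha ho (hA.preconnected _ _)
    rcases hx with hx | hx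
    · exact hAr x hx
    · obtain ⟨a, ha, hxa⟩ := hB x hx
      have h1 : (G.induce (A ∪ B)).Adj ⟨x, Or.inr hx⟩ ⟨a, Or.inl ha⟩ := hxa
      exact h1.reachable.trans (hAr a ha)
  rw [SimpleGraph.connected_iff]
  exact ⟨fun x y => (key x.1 x.2).trans (key y.1 y.2).symm, ⟨⟨o, Or.inl ho⟩⟩⟩

theorem connected_induce_insert {A : Set V} {v a : V} (hA : (G.induce A).Connected) (ha : a ∈ A)
    (h : G.Adj v a) : (G.induce (insert v A)).Connected := by
  have := connected_induce_union (B := {v}) hA (by rintro b rfl; exact ⟨a, ha, h⟩)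
  rwa [Set.union_singleton] at this

theorem exists_boundary_adj {A U : Set V} (hA : (G.induce A).Connected) {x y : V} (hx : x ∈ A)
    (hxU : x ∈ U) (hy : y ∈ A) (hyU : y ∉ U) :
    ∃ a b, a ∈ A ∧ a ∈ U ∧ b ∈ A ∧ b ∉ U ∧ G.Adj a b := by
  obtain ⟨p⟩ := hA.preconnected ⟨x, hx⟩ ⟨y, hy⟩
  obtain ⟨d, -, h1, h2⟩ := p.exists_boundary_dart {z | z.1 ∈ U} hxU hyU
  exact ⟨d.fst, d.snd, d.fst.2, h1, d.snd.2, h2, d.adj⟩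

theorem exists_boundary_adj' (hG : G.Connected) {U : Set V} {x y : V} (hxU : x ∈ U)
    (hyU : y ∉ U) : ∃ a b, a ∈ U ∧ b ∉ U ∧ G.Adj a b := by
  obtain ⟨p⟩ := hG.preconnected x y
  obtain ⟨d, -, h1, h2⟩ := p.exists_boundary_dart U hxU hyU
  exact ⟨d.fst, d.snd, h1, h2, d.adj⟩

/-- A shortest walk, as a sequence of vertices at increasing distance from its start. -/
theorem exists_geodesic (hG : G.Connected) (a b : V) :
    ∃ q : ℕ → V, q 0 = a ∧ q (G.dist a b) = b ∧
      (∀ i < G.dist a b, G.Adj (q i) (q (i + 1))) ∧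
      (∀ i ≤ G.dist a b, G.dist a (q i) = i ∧ G.dist (q i) b = G.dist a b - i) := by
  obtain ⟨p, hp⟩ := hG.exists_walk_length_eq_dist a b
  refine ⟨p.getVert, p.getVert_zero, by rw [← hp]; exact p.getVert_length,
    fun i hi => p.adj_getVert_succ (by omega), fun i hi => ?_⟩
  have h1 := SimpleGraph.dist_le (p.take i)
  have h2 := SimpleGraph.dist_le (p.drop i)
  have h3 := hG.dist_triangle (u := a) (v := p.getVert i) (w := b)
  simp only [SimpleGraph.Walk.take_length, SimpleGraph.Walk.drop_length] at h1 h2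
  omega

theorem connected_induce_path {q : ℕ → V} {l : ℕ} (hq : ∀ i < l, G.Adj (q i) (q (i + 1))) :
    (G.induce (q '' {i | i ≤ l})).Connected := by
  induction l with
  | zero =>
    have : q '' {i | i ≤ 0} = {q 0} := by simp
    rw [this]
    exact connected_induce_singleton _
  | succ l ih =>
    have : q '' {i | i ≤ l + 1} = insert (q (l + 1)) (q '' {i | i ≤ l}) := by
      ext x
      simp only [Set.mem_image, Set.mem_ofPred_eq, Set.mem_insert_iff]
      constructor
      · rintro ⟨i, hi, rfl⟩
        rcases Nat.lt_or_ge l i with h | h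
        · left; congr 1; omega
        · exact Or.inr ⟨i, h, rfl⟩
      · rintro (rfl | ⟨i, hi, rfl⟩)
        · exact ⟨l + 1, le_rfl, rfl⟩
        · exact ⟨i, by omega, rfl⟩
    rw [this]
    exact connected_induce_insert (ih fun i hi => hq i (by omega)) ⟨l, by simp, rfl⟩
      (hq l (by omega)).symm

end Connectedness

/-! ### Extending homomorphisms one vertex at a time -/

section Extension

variable {V : Type u} {W : Type v} {H : SimpleGraph V} {K : SimpleGraph W}

theorem HomOn.insert [DecidableEq V] {A : Set V} {φ : V → W} (h : HomOn H K A φ) {x : V} {w : W}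
    (hx : x ∉ A) (hw : ∀ a ∈ A, H.Adj x a → K.Adj w (φ a)) :
    HomOn H K (insert x A) (Function.update φ x w) := by
  intro b hb c hc hbc
  by_cases hbx : b = x <;> by_cases hcx : c = x
  · subst hbx; subst hcx; exact (H.loopless.irrefl _ hbc).elim
  · subst hbx
    rw [Function.update_self, Function.update_of_ne hcx]
    exact hw c (hc.resolve_left hcx) hbc
  · subst hcx
    rw [Function.update_self, Function.update_of_ne hbx]
    exact (hw b (hb.resolve_left hbx) hbc.symm).symm
  · rw [Function.update_of_ne hbx, Function.update_of_ne hcx]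
    exact h b (hb.resolve_left hbx) c (hc.resolve_left hcx) hbc

theorem Extends.exists_hom (h : Extends H K) {A : Set V} (hA : (H.induce A).Connected)
    {φ : V → W} (hφ : HomOn H K A φ) : ∃ ψ : H →g K, ∀ a ∈ A, ψ a = φ a := by
  obtain ⟨ψ, hψ⟩ := h A hA ⟨fun a => φ a, fun {a b} hab => hφ a a.2 b b.2 hab⟩
  exact ⟨ψ, fun a ha => hψ ⟨a, ha⟩⟩

/-- The image of `w` under an extension is such a vertex. Refutations use this form: `A` and `φ` are
chosen so that no such `z` can exist. -/
theorem Extends.exists_adj (h : Extends H K) {A : Set V} (hA : (H.induce A).Connected)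
    {φ : V → W} (hφ : HomOn H K A φ) (w : V) :
    ∃ z, ∀ a ∈ A, H.Adj w a → K.Adj z (φ a) := by
  obtain ⟨ψ, hψ⟩ := h.exists_hom hA hφ
  exact ⟨ψ w, fun a ha hwa => hψ a ha ▸ ψ.map_adj hwa⟩

theorem Extends.exists_hom_apply_eq (h : Extends H K) (a : V) (b : W) :
    ∃ ψ : H →g K, ψ a = b := by
  obtain ⟨ψ, hψ⟩ := h.exists_hom (φ := fun _ => b) (connected_induce_singleton a)
    (by rintro x rfl y rfl hxy; exact (H.loopless.irrefl _ hxy).elim)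
  exact ⟨ψ, hψ a rfl⟩

theorem extends_of_exists_hom [Nonempty W]
    (h : ∀ A : Set V, (H.induce A).Connected → ∀ φ : V → W, HomOn H K A φ →
      ∃ ψ : H →g K, ∀ a ∈ A, ψ a = φ a) : Extends H K := by
  classical
  intro A hA φ
  obtain ⟨ψ, hψ⟩ := h A hA
    (fun v => if hv : v ∈ A then φ ⟨v, hv⟩ else Classical.arbitrary W) (by
      intro a ha b hb hab
      simp only [ha, hb, dif_pos]
      exact φ.map_adj hab)
  refine ⟨ψ, fun a => ?_⟩
  rw [hψ a a.2, dif_pos a.2]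

/-- It suffices to extend homomorphisms by one adjacent vertex at a time. -/
theorem extends_of_exists_adj [Finite V] [Nonempty W] (hH : H.Connected)
    (h : ∀ A : Set V, (H.induce A).Connected → ∀ v ∉ A, (∃ a ∈ A, H.Adj v a) →
      ∀ φ : V → W, HomOn H K A φ → ∃ w, ∀ a ∈ A, H.Adj v a → K.Adj w (φ a)) :
    Extends H K := by
  classical
  refine extends_of_exists_hom fun A hA φ hφ => ?_
  obtain ⟨B, ⟨hAB, hB, χ, hχ, hχA⟩, hmax⟩ := Set.Finite.exists_maximal
    (s := {B : Set V | A ⊆ B ∧ (H.induce B).Connected ∧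
      ∃ χ : V → W, HomOn H K B χ ∧ ∀ a ∈ A, χ a = φ a}) (Set.toFinite _)
    ⟨A, subset_rfl, hA, φ, hφ, fun _ _ => rfl⟩
  have huniv : ∀ v, v ∈ B := by
    by_contra! hv
    obtain ⟨v, hv⟩ := hv
    obtain ⟨⟨o, ho⟩⟩ := hB.nonempty
    obtain ⟨a, x, ha, hx, hax⟩ := exists_boundary_adj' hH ho hv
    obtain ⟨w, hw⟩ := h B hB x hx ⟨a, ha, hax.symm⟩ χ hχ
    refine hx (hmax (y := insert x B) ⟨hAB.trans (Set.subset_insert _ _),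
      connected_induce_insert hB ha hax.symm, Function.update χ x w, hχ.insert hx hw, ?_⟩
      (Set.subset_insert _ _) (Set.mem_insert _ _))
    · intro b hb
      rw [Function.update_of_ne (by rintro rfl; exact hx (hAB hb))]
      exact hχA b hb
  exact ⟨⟨χ, fun {a b} hab => hχ a (huniv a) b (huniv b) hab⟩, hχA⟩

theorem Extends.congr_right {U : Type w} {L : SimpleGraph U} (h : Extends H K) (e : K ≃g L) :
    Extends H L := by
  intro A hA φ
  obtain ⟨ψ, hψ⟩ := h A hA (e.symm.toHom.comp φ)
  refine ⟨e.toHom.comp ψ, fun a => ?_⟩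
  change e (ψ a) = φ a
  rw [hψ a]
  exact e.apply_symm_apply _

end Extension

/-! ### Reduction to pairs of components -/

theorem isCHH_iff_extends_self {V : Type u} [Finite V] {G : SimpleGraph V} :
    IsCHH G ↔ Extends G G :=
  ⟨fun h A hA => h A (Set.toFinite _) hA, fun h A _ hA => h A hA⟩

theorem hom_mem_component {V : Type u} {G : SimpleGraph V} {A : Set V}
    (hA : (G.induce A).Connected) {φ : V → V} (hφ : HomOn G G A φ) {a b : V} (ha : a ∈ A)
    (hb : b ∈ A) : G.connectedComponentMk (φ a) = G.connectedComponentMk (φ b) := by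
  have h := (hA.preconnected ⟨a, ha⟩ ⟨b, hb⟩).map
    (⟨fun x => φ x, fun {x y} hxy => hφ x x.2 y y.2 hxy⟩ : G.induce A →g G)
  exact SimpleGraph.ConnectedComponent.sound h

/-- Connectedness confines the domain to one component `c` and the image to one component `d`. An
extension from `c` to `d` is completed by the identity on the other components; conversely, an
extension on `G` sends `c` into `d` because one vertex of `c` goes there. -/
theorem isCHH_iff_extends_components {V : Type u} [Finite V] {G : SimpleGraph V} :
    IsCHH G ↔ ∀ c d : G.ConnectedComponent, Extends c.toSimpleGraph d.toSimpleGraph := by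
  classical
  rw [isCHH_iff_extends_self]
  constructor
  · intro h c d
    have : Nonempty d := d.connected_toSimpleGraph.nonempty
    refine extends_of_exists_hom fun A hA φ hφ => ?_
    obtain ⟨⟨o, ho⟩⟩ := hA.nonempty
    have hA' : (G.induce (Subtype.val '' A)).Connected := by
      rw [SimpleGraph.connected_iff]
      refine ⟨?_, ⟨⟨o, o, ho, rfl⟩⟩⟩
      rintro ⟨_, x, hx, rfl⟩ ⟨_, y, hy, rfl⟩
      exact (hA.preconnected ⟨x, hx⟩ ⟨y, hy⟩).map
        (⟨fun z => ⟨z.1.1, z.1, z.2, rfl⟩, fun {a b} hab => hab⟩ :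
          c.toSimpleGraph.induce A →g G.induce (Subtype.val '' A))
    let φ' : V → V := fun v => if hv : v ∈ c then (φ ⟨v, hv⟩ : V) else v
    have hφ'val : ∀ x : c, φ' x = φ x := fun x => by
      have : (x : V) ∈ c := x.2
      simp only [φ', dif_pos this]
    obtain ⟨ψ, hψ⟩ := h.exists_hom hA' (φ := φ') (by
      rintro _ ⟨x, hx, rfl⟩ _ ⟨y, hy, rfl⟩ hxy
      simp only [hφ'val]
      exact hφ x hx y hy hxy)
    have hψd : ∀ x : c, ψ x ∈ d := by
      intro x
      have h1 : G.connectedComponentMk (ψ x) = G.connectedComponentMk (ψ o) :=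
        SimpleGraph.ConnectedComponent.sound
          ((c.connected_toSimpleGraph.preconnected x o).map (ψ.comp c.toSimpleGraph_hom))
      have h2 : ψ o = φ o := by rw [hψ o ⟨o, ho, rfl⟩, hφ'val]
      have h3 : G.connectedComponentMk (φ o : V) = d := (φ o).2
      change G.connectedComponentMk (ψ x) = d
      rw [h1, h2, h3]
    refine ⟨⟨fun x => ⟨ψ x, hψd x⟩, fun {a b} hab => ψ.map_adj hab⟩, fun a ha => ?_⟩
    apply Subtype.ext
    change ψ a = φ a
    rw [hψ a ⟨a, ha, rfl⟩, hφ'val]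
  · intro h A hA φ
    have key : ∀ φ : V → V, HomOn G G A φ → ∃ ψ : G →g G, ∀ a ∈ A, ψ a = φ a := by
      intro φ hφ
      obtain ⟨⟨o, ho⟩⟩ := hA.nonempty
      let c := G.connectedComponentMk o
      let d := G.connectedComponentMk (φ o)
      have hAc : ∀ a ∈ A, a ∈ c := fun a ha =>
        hom_mem_component hA (φ := id) (fun _ _ _ _ h => h) ha ho
      have hAd : ∀ a ∈ A, φ a ∈ d := fun a ha => hom_mem_component hA hφ ha ho
      let B : Set c := {x | x.1 ∈ A}
      have hB : (c.toSimpleGraph.induce B).Connected := by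
        rw [SimpleGraph.connected_iff]
        refine ⟨?_, ⟨⟨⟨o, hAc o ho⟩, ho⟩⟩⟩
        rintro ⟨⟨x, hxc⟩, hx⟩ ⟨⟨y, hyc⟩, hy⟩
        exact (hA.preconnected ⟨x, hx⟩ ⟨y, hy⟩).map
          (⟨fun z => ⟨⟨z.1, hAc z.1 z.2⟩, z.2⟩, fun {a b} hab => hab⟩ :
            G.induce A →g c.toSimpleGraph.induce B)
      obtain ⟨χ, hχ⟩ := h c d B hB
        ⟨fun z => ⟨φ z.1.1, hAd _ z.2⟩, fun {a b} hab => hφ a.1.1 a.2 b.1.1 b.2 hab⟩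
      refine ⟨⟨fun v => if hv : v ∈ c then (χ ⟨v, hv⟩ : V) else v, fun {a b} hab => ?_⟩, ?_⟩
      · have hiff : a ∈ c ↔ b ∈ c := c.mem_supp_congr_adj hab
        by_cases ha : a ∈ c
        · simp only [dif_pos ha, dif_pos (hiff.1 ha)]
          exact χ.map_adj (v := ⟨a, ha⟩) (w := ⟨b, hiff.1 ha⟩) hab
        · simp only [dif_neg ha, dif_neg (mt hiff.2 ha)]
          exact hab
      · intro a ha
        change (if hv : a ∈ c then (χ ⟨a, hv⟩ : V) else a) = φ a
        rw [dif_pos (hAc a ha)]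
        exact congrArg Subtype.val (hχ ⟨⟨a, hAc a ha⟩, ha⟩)
    obtain ⟨ψ, hψ⟩ := key (fun v => if hv : v ∈ A then φ ⟨v, hv⟩ else v) (by
      intro a ha b hb hab
      simp only [ha, hb, dif_pos]
      exact φ.map_adj hab)
    refine ⟨ψ, fun a => ?_⟩
    rw [hψ a a.2, dif_pos a.2]

/-! ### Induced paths, cycles and the two-squares graph -/

section Paths

variable {V : Type u} {W : Type v} {G : SimpleGraph V} {H : SimpleGraph V} {K : SimpleGraph W}

/-- The vertices `q 0, …, q l` are distinct and induce a path in `G`. -/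
def IsInducedPath (G : SimpleGraph V) (q : ℕ → V) (l : ℕ) : Prop :=
  ∀ i j, i < j → j ≤ l → q i ≠ q j ∧ (G.Adj (q i) (q j) ↔ j = i + 1)

theorem IsInducedPath.injOn {q : ℕ → V} {l : ℕ} (h : IsInducedPath G q l) {i j : ℕ} (hi : i ≤ l)
    (hj : j ≤ l) (hij : q i = q j) : i = j := by
  rcases lt_trichotomy i j with h' | h' | h'
  · exact ((h i j h' hj).1 hij).elim
  · exact h'
  · exact ((h j i h' hi).1 hij.symm).elim

theorem IsInducedPath.adj_iff {q : ℕ → V} {l : ℕ} (h : IsInducedPath G q l) {i j : ℕ} (hi : i ≤ l)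
    (hj : j ≤ l) : G.Adj (q i) (q j) ↔ j = i + 1 ∨ i = j + 1 := by
  rcases lt_trichotomy i j with h' | h' | h'
  · rw [(h i j h' hj).2]; omega
  · subst h'; simp
  · rw [G.adj_comm, (h j i h' hi).2]; omega

theorem cycleGraph_adj_iff_val {k : ℕ} (hk : 3 ≤ k) (a b : Fin k) :
    (SimpleGraph.cycleGraph k).Adj a b ↔
      (b.val = a.val + 1 ∨ a.val = b.val + 1) ∨
        (a.val = 0 ∧ b.val + 1 = k) ∨ (b.val = 0 ∧ a.val + 1 = k) := by
  have ha := a.2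
  have hb := b.2
  rw [SimpleGraph.cycleGraph_adj', Fin.sub_def, Fin.sub_def]
  simp only
  rcases lt_trichotomy a.val b.val with h | h | h
  · rw [Nat.mod_eq_of_lt (show k - b.val + a.val < k by omega),
      show k - a.val + b.val = (b.val - a.val) + k by omega, Nat.add_mod_right,
      Nat.mod_eq_of_lt (by omega)]
    omega
  · rw [h, show k - b.val + b.val = k by omega, Nat.mod_self]
    omega
  · rw [Nat.mod_eq_of_lt (show k - a.val + b.val < k by omega),
      show k - b.val + a.val = (a.val - b.val) + k by omega, Nat.add_mod_right,
      Nat.mod_eq_of_lt (by omega)]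
    omega

theorem twoSquares_adj_iff_val (a b : Fin 6) :
    twoSquares.Adj a b ↔
      (b.val = a.val + 1 ∨ a.val = b.val + 1) ∨
        (a.val = 0 ∧ (b.val = 5 ∨ b.val = 3)) ∨ (b.val = 0 ∧ (a.val = 5 ∨ a.val = 3)) := by
  rw [twoSquares, SimpleGraph.sup_adj, cycleGraph_adj_iff_val (by norm_num),
    SimpleGraph.edge_adj]
  simp only [Fin.ext_iff, Fin.isValue, Fin.val_zero, ne_eq,
    show ((3 : Fin 6) : ℕ) = 3 from rfl]
  omega

/-- A vertex adjacent to exactly the ends of an induced path closes it to an induced cycle. -/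
theorem IsInducedPath.exists_cycle {q : ℕ → V} {l : ℕ} (h : IsInducedPath G q l) (hl : 1 ≤ l)
    {v : V} (hv : ∀ i ≤ l, v ≠ q i) (hadj : ∀ i ≤ l, (G.Adj v (q i) ↔ i = 0 ∨ i = l)) :
    ∃ f : SimpleGraph.cycleGraph (l + 2) ↪g G, (∀ i ≤ l, ∃ j, f j = q i) ∧ ∃ j, f j = v := by
  let F : Fin (l + 2) → V := fun j => if j.val ≤ l then q j else v
  have hF : Function.Injective F := by
    intro a b hab
    have ha := a.2
    have hb := b.2
    simp only [F] at hab
    by_cases h1 : a.val ≤ l <;> by_cases h2 : b.val ≤ l <;>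
      simp only [h1, h2, if_true, if_false] at hab
    · exact Fin.ext (h.injOn h1 h2 hab)
    · exact (hv _ h1 hab.symm).elim
    · exact (hv _ h2 hab).elim
    · exact Fin.ext (by omega)
  refine ⟨⟨⟨F, hF⟩, fun {a b} => ?_⟩, fun i hi => ?_, ⟨l + 1, by omega⟩, ?_⟩
  · have ha := a.2
    have hb := b.2
    rw [cycleGraph_adj_iff_val (by omega)]
    change G.Adj (F a) (F b) ↔ _
    simp only [F]
    by_cases h1 : a.val ≤ l <;> by_cases h2 : b.val ≤ l <;> simp only [h1, h2, if_true, if_false]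
    · rw [h.adj_iff h1 h2]; omega
    · rw [G.adj_comm, hadj _ h1]; omega
    · rw [hadj _ h2]; omega
    · simp only [SimpleGraph.irrefl, false_iff]; omega
  · refine ⟨⟨i, by omega⟩, ?_⟩
    change (if i ≤ l then q i else v) = q i
    rw [if_pos hi]
  · change (if l + 1 ≤ l then _ else v) = v
    rw [if_neg (by omega)]

/-- Here `v` plays vertex 0, an end of the long diagonal, and `q i` plays vertex `i + 1`; the
diagonal is the edge from `v` to `q 2`. -/
theorem IsInducedPath.twoSquares_isIndContained {q : ℕ → V} (h : IsInducedPath G q 4) {v : V}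
    (hv : ∀ i ≤ 4, v ≠ q i) (hadj : ∀ i ≤ 4, (G.Adj v (q i) ↔ i = 0 ∨ i = 2 ∨ i = 4)) :
    twoSquares.IsIndContained G := by
  let F : Fin 6 → V := fun j => if j.val = 0 then v else q (j.val - 1)
  have hF : Function.Injective F := by
    intro a b hab
    have ha := a.2
    have hb := b.2
    simp only [F] at hab
    by_cases h1 : a.val = 0 <;> by_cases h2 : b.val = 0 <;>
      simp only [h1, h2, if_true, if_false] at hab
    · exact Fin.ext (h1.trans h2.symm)
    · exact (hv (b.val - 1) (by omega) hab).elim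
    · exact (hv (a.val - 1) (by omega) hab.symm).elim
    · have := h.injOn (i := a.val - 1) (j := b.val - 1) (by omega) (by omega) hab
      exact Fin.ext (by omega)
  refine ⟨⟨⟨F, hF⟩, fun {a b} => ?_⟩⟩
  · have ha := a.2
    have hb := b.2
    rw [twoSquares_adj_iff_val]
    change G.Adj (F a) (F b) ↔ _
    simp only [F]
    by_cases h1 : a.val = 0 <;> by_cases h2 : b.val = 0
    · simp [h1, h2]
    · rw [if_pos h1, if_neg h2, hadj (b.val - 1) (by omega)]; omega
    · rw [if_neg h1, if_pos h2, G.adj_comm, hadj (a.val - 1) (by omega)]; omega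
    · rw [if_neg h1, if_neg h2, h.adj_iff (i := a.val - 1) (j := b.val - 1) (by omega) (by omega)]; omega

/-- Removing the last vertex of the cycle leaves the path, and the removed vertex is `v`. -/
theorem exists_inducedPath_of_cycle {k : ℕ} (hk : 4 ≤ k) (f : SimpleGraph.cycleGraph k ↪g G) :
    ∃ q v, IsInducedPath G q (k - 2) ∧ (∀ i ≤ k - 2, v ≠ q i) ∧
      G.Adj v (q 0) ∧ G.Adj v (q (k - 2)) := by
  refine ⟨fun i => f ⟨i % k, Nat.mod_lt _ (by omega)⟩, f ⟨k - 1, by omega⟩, ?_, ?_, ?_, ?_⟩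
  · intro i j hij hj
    refine ⟨fun h => ?_, ?_⟩
    · have := congrArg Fin.val (f.injective h)
      simp only [Nat.mod_eq_of_lt (show i < k by omega), Nat.mod_eq_of_lt (show j < k by omega)]
        at this
      omega
    · rw [f.map_adj_iff, cycleGraph_adj_iff_val (by omega)]
      simp only [Nat.mod_eq_of_lt (show i < k by omega), Nat.mod_eq_of_lt (show j < k by omega)]
      omega
  · intro i hi h
    have := congrArg Fin.val (f.injective h)
    simp only [Nat.mod_eq_of_lt (show i < k by omega)] at this
    omega
  · rw [f.map_adj_iff, cycleGraph_adj_iff_val (by omega)]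
    exact Or.inr (Or.inr ⟨Nat.zero_mod k, Nat.sub_add_cancel (by omega)⟩)
  · rw [f.map_adj_iff, cycleGraph_adj_iff_val (by omega)]
    simp only [Nat.mod_eq_of_lt (show k - 2 < k by omega)]
    omega

theorem exists_inducedPath_of_twoSquares (f : twoSquares ↪g G) :
    ∃ q v, IsInducedPath G q 4 ∧ G.Adj v (q 0) ∧ G.Adj v (q 4) := by
  refine ⟨fun i => f ⟨(i + 1) % 6, Nat.mod_lt _ (by omega)⟩, f 0, ?_, ?_, ?_⟩
  · intro i j hij hj
    refine ⟨fun h => ?_, ?_⟩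
    · have := congrArg Fin.val (f.injective h)
      simp only [Nat.mod_eq_of_lt (show i + 1 < 6 by omega),
        Nat.mod_eq_of_lt (show j + 1 < 6 by omega)] at this
      omega
    · rw [f.map_adj_iff, twoSquares_adj_iff_val]
      simp only [Nat.mod_eq_of_lt (show i + 1 < 6 by omega),
        Nat.mod_eq_of_lt (show j + 1 < 6 by omega)]
      omega
  · rw [f.map_adj_iff, twoSquares_adj_iff_val]; simp
  · rw [f.map_adj_iff, twoSquares_adj_iff_val]; simp

/-- The length of an induced path with a common neighbour of its ends in `H` is such that the ends
of every walk of that length in `K` have a common neighbour. -/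
theorem Extends.exists_common_adj_of_walk (h : Extends H K) {q : ℕ → V} {l : ℕ}
    (hq : IsInducedPath H q l) {v : V} (h0 : H.Adj v (q 0)) (hl : H.Adj v (q l)) {a b : W}
    (p : K.Walk a b) (hp : p.length = l) : ∃ z, K.Adj z a ∧ K.Adj z b := by
  classical
  have hconn : (H.induce (q '' {i | i ≤ l})).Connected :=
    connected_induce_path fun i hi => (hq.adj_iff (by omega) (by omega)).2 (Or.inl rfl)
  -- Since the path is induced, sending its vertices in order to those of the walk is a
  -- homomorphism, even if the walk repeats vertices. An extension then carries `v` to the required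
  -- vertex.
  let φ : V → W := fun x => if hx : ∃ i ≤ l, q i = x then p.getVert hx.choose else a
  have hφ : ∀ i ≤ l, φ (q i) = p.getVert i := by
    intro i hi
    have hx : ∃ j ≤ l, q j = q i := ⟨i, hi, rfl⟩
    simp only [φ, dif_pos hx]
    rw [hq.injOn hx.choose_spec.1 hi hx.choose_spec.2]
  obtain ⟨z, hz⟩ := h.exists_adj hconn (φ := φ) (by
    rintro _ ⟨i, hi, rfl⟩ _ ⟨j, hj, rfl⟩ hij
    simp only [Set.mem_ofPred_eq] at hi hj
    rw [hφ i hi, hφ j hj]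
    rcases (hq.adj_iff hi hj).1 hij with rfl | rfl
    · exact p.adj_getVert_succ (by omega)
    · exact (p.adj_getVert_succ (by omega)).symm) v
  have e0 := hz (q 0) ⟨0, by simp, rfl⟩ h0
  have el := hz (q l) ⟨l, by simp, rfl⟩ hl
  rw [hφ 0 (by omega), p.getVert_zero] at e0
  rw [hφ l le_rfl, ← hp, p.getVert_length] at el
  exact ⟨z, e0, el⟩

/-- Induction along shortest paths of `A` between neighbours of `v`. -/
theorem forall_neighbours_of_geodesic {A : Set V} (hA : (G.induce A).Connected) {v : V}
    {R : V → V → Prop}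
    (step : ∀ (q : ℕ → V) (l : ℕ), IsInducedPath G q l → (∀ i ≤ l, q i ∈ A) → 1 ≤ l →
      G.Adj v (q 0) → G.Adj v (q l) →
      (∀ i j, i ≤ j → j ≤ l → ∀ z ∈ A, G.Adj z (q i) → G.Adj z (q j) → j ≤ i + 2) →
      (∀ i, 0 < i → i < l → G.Adj v (q i) → R (q 0) (q i) ∧ R (q i) (q l)) → R (q 0) (q l))
    {a b : V} (ha : a ∈ A) (hb : b ∈ A) (hab : a ≠ b) (hva : G.Adj v a) (hvb : G.Adj v b) :
    R a b := by
  suffices h : ∀ (n : ℕ) (a b : A), (G.induce A).dist a b = n → a ≠ b → G.Adj v a → G.Adj v b →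
      R a b from h _ ⟨a, ha⟩ ⟨b, hb⟩ rfl (by simpa using hab) hva hvb
  intro n
  induction n using Nat.strong_induction_on with
  | _ n ih =>
  intro a b hn hab hva hvb
  obtain ⟨q, q0, qn, hq, hd⟩ := exists_geodesic hA a b
  rw [hn] at qn hq hd
  have hpos : 0 < n := by
    rw [← hn]
    exact hA.pos_dist_of_ne hab
  -- Distance from `a` changes by at most one along an edge. Hence the geodesic is induced, and two
  -- of its vertices with a common neighbour in `A` are at most two steps apart.
  have hlip : ∀ x y : A, (G.induce A).Adj x y →
      (G.induce A).dist a y ≤ (G.induce A).dist a x + 1 := fun x y hxy => by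
    have := hA.dist_triangle (u := a) (v := x) (w := y)
    rwa [SimpleGraph.dist_eq_one_iff_adj.2 hxy] at this
  have := step (fun i => (q i : V)) n ?_ (fun i _ => (q i).2) hpos (by simpa [q0] using hva)
    (by simpa [qn] using hvb) ?_ ?_
  · simpa [q0, qn] using this
  · intro i j hij hj
    have hi' := (hd i (by omega)).1
    have hj' := (hd j hj).1
    refine ⟨fun h => ?_, fun h => ?_, ?_⟩
    · rw [Subtype.ext h] at hi'
      omega
    · have := hlip (q i) (q j) h
      omega
    · rintro rfl
      exact hq i (by omega)
  · intro i j hij hj z hz hzi hzj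
    have h1 := hlip (q i) ⟨z, hz⟩ hzi.symm
    have h2 := hlip ⟨z, hz⟩ (q j) hzj
    have := (hd i (by omega)).1
    have := (hd j hj).1
    omega
  · intro i hi0 hil hvi
    have hdi := hd i (by omega)
    constructor
    · refine ih i hil (q 0) (q i) (by rw [q0]; exact hdi.1) ?_ (by simpa [q0] using hva) hvi
      rintro h
      rw [q0] at h
      rw [← h, SimpleGraph.dist_self] at hdi
      omega
    · refine ih (n - i) (by omega) (q i) (q n) (by rw [qn]; rw [hdi.2]) ?_ hvi
        (by simpa [qn] using hvb)
      rintro h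
      rw [qn] at h
      rw [h, SimpleGraph.dist_self] at hdi
      omega

end Paths

/-! ### Sufficiency of (c) -/

section Squares

variable {V : Type u} {W : Type v} {H : SimpleGraph V} {K : SimpleGraph W}

theorem AllInducedCyclesSquares.not_triangle (h : AllInducedCyclesSquares H) {a b c : V}
    (hab : H.Adj a b) (hac : H.Adj a c) (hbc : H.Adj b c) : False := by
  have hq : IsInducedPath H (fun i => if i = 0 then b else c) 1 := by
    intro i j hij hj
    obtain rfl : j = 1 := by omega
    obtain rfl : i = 0 := by omega
    simp [hbc, hbc.ne]
  obtain ⟨f, -⟩ := hq.exists_cycle (v := a) le_rfl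
    (by intro i hi; interval_cases i <;> simp [hab.ne, hac.ne])
    (by intro i hi; interval_cases i <;> simp [hab, hac])
  have := h 3 le_rfl ⟨f⟩
  omega

/-- On a geodesic in `A` of length greater than two between neighbours of `v`, an inner neighbour of
`v` can only be the middle of a path of length four, which gives a two-squares graph. Without inner
neighbours, `v` closes an induced cycle longer than a square. -/
theorem exists_common_neighbour_of_squares {A : Set V} (hA : (H.induce A).Connected) {v : V}
    (hv : v ∉ A) (h : AllInducedCyclesSquares H) (h2 : ¬ twoSquares.IsIndContained H) {a b : V}
    (ha : a ∈ A) (hb : b ∈ A) (hab : a ≠ b) (hva : H.Adj v a) (hvb : H.Adj v b) :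
    ∃ z ∈ A, H.Adj z a ∧ H.Adj z b := by
  refine forall_neighbours_of_geodesic hA (R := fun a b => ∃ z ∈ A, H.Adj z a ∧ H.Adj z b)
    ?_ ha hb hab hva hvb
  intro q l hq hqA hl h0 hvl hgeo hR
  have hvq : ∀ i ≤ l, v ≠ q i := by
    rintro i hi rfl
    exact hv (hqA i hi)
  have hntri : ∀ i, i + 1 ≤ l → H.Adj v (q i) → ¬ H.Adj v (q (i + 1)) := fun i hi h3 h4 =>
    h.not_triangle h3 h4 ((hq.adj_iff (by omega) hi).2 (Or.inl rfl))
  have hl1 : l ≠ 1 := by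
    rintro rfl
    exact hntri 0 le_rfl h0 hvl
  by_cases hl2 : l = 2
  · subst hl2
    exact ⟨q 1, hqA 1 (by omega), (hq.adj_iff (by omega) (by omega)).2 (Or.inr rfl),
      (hq.adj_iff (by omega) (by omega)).2 (Or.inl rfl)⟩
  exfalso
  have hmid : ∀ i, 0 < i → i < l → H.Adj v (q i) → i = 2 ∧ l = 4 := by
    intro i hi hil hvi
    obtain ⟨⟨z, hz, hz1, hz2⟩, z', hz', hz3, hz4⟩ := hR i hi hil hvi
    have h3 := hgeo 0 i (by omega) (by omega) z hz hz1 hz2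
    have h4 := hgeo i l (by omega) (by omega) z' hz' hz3 hz4
    -- The induction hypothesis gives `i ≤ 2` and `l ≤ i + 2`; triangle-freeness excludes one step
    -- on either side.
    have h5 : i ≠ 1 := by
      rintro rfl
      exact hntri 0 (by omega) h0 hvi
    have h6 : l ≠ i + 1 := by
      rintro rfl
      exact hntri i (by omega) hvi hvl
    omega
  by_cases hex : ∃ i, 0 < i ∧ i < l ∧ H.Adj v (q i)
  · obtain ⟨i, hi, hil, hvi⟩ := hex
    obtain ⟨rfl, rfl⟩ := hmid i hi hil hvi
    refine h2 (hq.twoSquares_isIndContained hvq fun i hi => ⟨fun hvi' => ?_, ?_⟩)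
    · by_cases hi0 : i = 0
      · exact Or.inl hi0
      · by_cases hi4 : i = 4
        · omega
        · have := hmid i (by omega) (by omega) hvi'
          omega
    · rintro (rfl | rfl | rfl) <;> assumption
  · push Not at hex
    obtain ⟨f, -⟩ := hq.exists_cycle (v := v) (by omega) hvq fun i hi => ⟨fun hvi => by
      by_contra hcon
      exact hex i (by omega) (by omega) hvi, by rintro (rfl | rfl) <;> assumption⟩
    have := h _ (by omega) ⟨f⟩
    omega

/-- Pairwise common neighbours are upgraded to one vertex `z` of `A` adjacent to every neighbour of
`v` in `A`, by maximising the number of these that `z` sees. The new vertex `v` can then be sent to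
`φ z`. -/
theorem extends_of_squares [Finite V] (hH : H.Connected) (h : AllInducedCyclesSquares H)
    (h2 : ¬ twoSquares.IsIndContained H) (hK : K.Connected) [Nontrivial W] : Extends H K := by
  classical
  have : Nonempty W := hK.nonempty
  refine extends_of_exists_adj hH fun A hA v hv hvA φ hφ => ?_
  obtain ⟨a, ha, hva⟩ := hvA
  by_cases hone : ∀ b ∈ A, H.Adj v b → b = a
  · obtain ⟨w, hw⟩ := hK.preconnected.exists_adj_of_nontrivial (φ a)
    refine ⟨w, fun b hb hvb => ?_⟩
    rw [hone b hb hvb]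
    exact hw.symm
  push Not at hone
  obtain ⟨b, hb, hvb, hba⟩ := hone
  obtain ⟨z₀, hz₀A, -⟩ := exists_common_neighbour_of_squares hA hv h h2 ha hb hba.symm hva hvb
  obtain ⟨z, hzA, hz⟩ := Set.exists_max_image A (fun z => {x | x ∈ A ∧ H.Adj v x ∧ H.Adj z x}.ncard)
    (Set.toFinite A) ⟨z₀, hz₀A⟩
  have hcom : ∀ x ∈ A, ∀ y ∈ A, H.Adj v x → H.Adj v y → ∃ z ∈ A, H.Adj z x ∧ H.Adj z y := by
    intro x hx y hy hvx hvy
    by_cases hxy : x = y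
    · subst hxy
      by_cases hxa : x = a
      · subst hxa
        obtain ⟨z, h1, h2, h3⟩ :=
          exists_common_neighbour_of_squares hA hv h h2 hx hb hba.symm hvx hvb
        exact ⟨z, h1, h2, h2⟩
      · obtain ⟨z, h1, h2, h3⟩ :=
          exists_common_neighbour_of_squares hA hv h h2 hx ha hxa hvx hva
        exact ⟨z, h1, h2, h2⟩
    · exact exists_common_neighbour_of_squares hA hv h h2 hx hy hxy hvx hvy
  suffices hall : ∀ c ∈ A, H.Adj v c → H.Adj z c from
    ⟨φ z, fun c hc hvc => hφ z hzA c hc (hall c hc hvc)⟩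
  by_contra! hcon
  obtain ⟨c, hc, hvc, hzc⟩ := hcon
  obtain ⟨a', ha', hva', hza'⟩ : ∃ a' ∈ A, H.Adj v a' ∧ H.Adj z a' := by
    obtain ⟨z₁, hz₁, h3, -⟩ := hcom a ha a ha hva hva
    have h4 := hz z₁ hz₁
    have h5 : 0 < {x | x ∈ A ∧ H.Adj v x ∧ H.Adj z₁ x}.ncard :=
      (Set.ncard_pos (Set.toFinite _)).2 ⟨a, ha, hva, h3⟩
    obtain ⟨x, hx⟩ := (Set.ncard_pos (Set.toFinite _)).1 (lt_of_lt_of_le h5 h4)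
    exact ⟨x, hx⟩
  obtain ⟨z', hz'A, hz'a, hz'c⟩ := hcom a' ha' c hc hva' hvc
  -- As `z'` sees `c` and `z` does not, maximality of `z` gives a `b'` seen only by `z`. Then b', z,
  -- a', z', c is an induced path, and `v` sees its ends and its middle: a two-squares graph.
  obtain ⟨b', hb', hvb', hzb', hz'b'⟩ :
      ∃ b' ∈ A, H.Adj v b' ∧ H.Adj z b' ∧ ¬ H.Adj z' b' := by
    by_contra! hsub
    have h6 : {x | x ∈ A ∧ H.Adj v x ∧ H.Adj z x} ⊂ {x | x ∈ A ∧ H.Adj v x ∧ H.Adj z' x} := by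
      refine ⟨fun x hx => ⟨hx.1, hx.2.1, hsub x hx.1 hx.2.1 hx.2.2⟩, fun hle => ?_⟩
      exact hzc (hle ⟨hc, hvc, hz'c⟩).2.2
    have h7 := Set.ncard_lt_ncard h6 (Set.toFinite _)
    have h8 := hz z' hz'A
    omega
  have ntri := fun {x y z} => h.not_triangle (a := x) (b := y) (c := z)
  have hvz : ¬ H.Adj v z := fun h9 => ntri h9 hva' hza'
  have hvz' : ¬ H.Adj v z' := fun h9 => ntri h9 hva' hz'a
  have hzz' : ¬ H.Adj z z' := fun h9 => ntri h9 hza' hz'a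
  have hba' : ¬ H.Adj b' a' := fun h9 => ntri hvb' hva' h9
  have hbc : ¬ H.Adj b' c := fun h9 => ntri hvb' hvc h9
  have hac : ¬ H.Adj a' c := fun h9 => ntri hva' hvc h9
  have hz'b'' : ¬ H.Adj b' z' := fun h9 => hz'b' h9.symm
  let q : ℕ → V := fun i => if i = 0 then b' else if i = 1 then z else if i = 2 then a' else
    if i = 3 then z' else c
  have hq : IsInducedPath H q 4 := by
    intro i j hij hj
    have e1 : b' ≠ a' := by rintro rfl; exact hz'b' hz'a
    have e2 : b' ≠ z' := by rintro rfl; exact hvz' hvb'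
    have e3 : b' ≠ c := by rintro rfl; exact hz'b' hz'c
    have e4 : z ≠ z' := by rintro rfl; exact hzc hz'c
    have e5 : z ≠ c := by rintro rfl; exact hvz hvc
    have e6 : a' ≠ c := by rintro rfl; exact hzc hza'
    interval_cases j <;> interval_cases i <;>
      simp [q, e1, e2, e3, e4, e5, e6, hzb'.ne', hza'.ne, hz'a.ne', hz'c.ne, hzb'.symm, hza',
        hz'a.symm, hz'c, hzz', hba', hbc, hac, hz'b'', hzc]
  refine h2 (hq.twoSquares_isIndContained (v := v) ?_ ?_)
  · intro i hi
    have : q i ∈ A := by interval_cases i <;> simp [q, *]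
    rintro rfl
    exact hv this
  · intro i hi
    interval_cases i <;> simp [q, hvb', hva', hvc, hvz, hvz']

end Squares

/-! ### Sufficiency of (b) -/

section Treelike

variable {V : Type u} {W : Type v} {H : SimpleGraph V} {K : SimpleGraph W} {n : ℕ}

/-- A triangle is an induced cycle, hence lies in one copy of K_n, and that copy is determined by
any edge of the triangle. So the copy through one edge of `s` contains all of `s`. -/
theorem IsTreelike.exists_isNClique (h : IsTreelike n H) {s : Set V} (hs : H.IsClique s)
    (hne : s.Nonempty) : ∃ C : Finset V, H.IsNClique n C ∧ s ⊆ C := by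
  obtain ⟨-, -, 𝒞, hclq, hcov, hedge, hint, hcyc⟩ := h
  obtain ⟨a, ha⟩ := hne
  by_cases hone : ∀ b ∈ s, b = a
  · obtain ⟨C, hC, haC⟩ := hcov a
    exact ⟨C, hclq C hC, fun b hb => by rw [hone b hb]; exact haC⟩
  push Not at hone
  obtain ⟨b, hb, hba⟩ := hone
  obtain ⟨C, hC, haC, hbC⟩ := hedge a b (hs ha hb hba.symm)
  refine ⟨C, hclq C hC, fun c hc => ?_⟩
  by_cases hca : c = a
  · rw [hca]; exact haC
  by_cases hcb : c = b
  · rw [hcb]; exact hbC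
  have hab := hs ha hb hba.symm
  have hac := hs hc ha hca
  have hbc := hs hc hb hcb
  have hq : IsInducedPath H (fun i => if i = 0 then a else b) 1 := by
    intro i j hij hj
    obtain rfl : j = 1 := by omega
    obtain rfl : i = 0 := by omega
    simp [hab, hab.ne]
  obtain ⟨f, hf, jc, hfc⟩ := hq.exists_cycle (v := c) le_rfl
    (by intro i hi; interval_cases i <;> simp [hca, hcb])
    (by intro i hi; interval_cases i <;> simp [hac, hbc])
  obtain ⟨D, hD, hfD⟩ := hcyc _ le_rfl f
  obtain ⟨ja, hja⟩ := hf 0 (by omega)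
  obtain ⟨jb, hjb⟩ := hf 1 (by omega)
  simp only [if_true, one_ne_zero, if_false] at hja hjb
  have hDC : D = C := by
    by_contra hne
    exact hba (hint D hD C hC hne ⟨hjb ▸ hfD jb, hbC⟩ ⟨hja ▸ hfD ja, haC⟩)
  rw [← hDC, ← hfc]
  exact hfD jc

theorem IsTreelike.adj_of_common_edge (h : IsTreelike n H) {a b c d : V} (hab : H.Adj a b)
    (hac : H.Adj a c) (hbc : H.Adj b c) (hda : H.Adj d a) (hdb : H.Adj d b) (hcd : c ≠ d) :
    H.Adj c d := by
  classical
  have htri : ∀ x, H.Adj a x → H.Adj b x → H.IsClique ({a, b, x} : Set V) := by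
    intro x hax hbx y hy z hz hyz
    rcases hy with rfl | rfl | rfl <;> rcases hz with rfl | rfl | rfl <;>
      first | exact (hyz rfl).elim | assumption | (apply SimpleGraph.Adj.symm; assumption)
  obtain ⟨h2, hconn, 𝒞, hclq, hcov, hedge, hint, hcyc⟩ := h
  have hin : ∀ x, H.Adj a x → H.Adj b x → ∃ D ∈ 𝒞, a ∈ D ∧ b ∈ D ∧ x ∈ D := by
    intro x hax hbx
    have hq : IsInducedPath H (fun i => if i = 0 then a else b) 1 := by
      intro i j hij hj
      obtain rfl : j = 1 := by omega
      obtain rfl : i = 0 := by omega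
      simp [hab, hab.ne]
    obtain ⟨f, hf, jc, hfc⟩ := hq.exists_cycle (v := x) le_rfl
      (by intro i hi; interval_cases i <;> simp [hax.ne', hbx.ne'])
      (by intro i hi; interval_cases i <;> simp [hax.symm, hbx.symm])
    obtain ⟨D, hD, hfD⟩ := hcyc _ le_rfl f
    obtain ⟨ja, hja⟩ := hf 0 (by omega)
    obtain ⟨jb, hjb⟩ := hf 1 (by omega)
    simp only [if_true, one_ne_zero, if_false] at hja hjb
    exact ⟨D, hD, hja ▸ hfD ja, hjb ▸ hfD jb, hfc ▸ hfD jc⟩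
  obtain ⟨C, hC, haC, hbC, hcC⟩ := hin c hac hbc
  obtain ⟨D, hD, haD, hbD, hdD⟩ := hin d hda.symm hdb.symm
  have hDC : D = C := by
    by_contra hne
    exact hab.ne (hint D hD C hC hne ⟨haD, haC⟩ ⟨hbD, hbC⟩)
  subst hDC
  exact (hclq D hD).isClique hcC hdD hcd

/-- On a geodesic of length at least two, an inner neighbour of `v` is by induction adjacent to both
ends, and the two triangles on its edge with `v` make the ends adjacent. With no inner neighbour,
`v` closes a long induced cycle, which would lie in a clique. -/
theorem IsTreelike.adj_of_neighbours (h : IsTreelike n H) {A : Set V}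
    (hA : (H.induce A).Connected) {v : V} (hv : v ∉ A) {a b : V} (ha : a ∈ A) (hb : b ∈ A)
    (hab : a ≠ b) (hva : H.Adj v a) (hvb : H.Adj v b) : H.Adj a b := by
  refine forall_neighbours_of_geodesic hA (R := H.Adj) ?_ ha hb hab hva hvb
  intro q l hq hqA hl h0 hvl _ hR
  by_cases hl1 : l = 1
  · subst hl1
    exact (hq.adj_iff (by omega) le_rfl).2 (Or.inl rfl)
  exfalso
  have h02 : ¬ H.Adj (q 0) (q 2) := by
    rw [hq.adj_iff (by omega) (by omega)]
    omega
  have hne02 : q 0 ≠ q 2 := (hq 0 2 (by omega) (by omega)).1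
  by_cases hex : ∃ i, 0 < i ∧ i < l ∧ H.Adj v (q i)
  · obtain ⟨i, hi, hil, hvi⟩ := hex
    obtain ⟨h1, h2⟩ := hR i hi hil hvi
    have hi1 := (hq.adj_iff (by omega) (by omega)).1 h1
    have hl2 := (hq.adj_iff (by omega) (by omega)).1 h2
    obtain rfl : i = 1 := by omega
    obtain rfl : l = 2 := by omega
    exact h02 (h.adj_of_common_edge (a := v) (b := q 1) hvi h0 h1.symm hvl.symm h2.symm hne02)
  · push Not at hex
    obtain ⟨f, hf, -⟩ := hq.exists_cycle (v := v) (by omega)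
      (by rintro i hi rfl; exact hv (hqA i hi)) fun i hi => ⟨fun hvi => by
        by_contra hcon
        exact hex i (by omega) (by omega) hvi, by rintro (rfl | rfl) <;> assumption⟩
    obtain ⟨-, -, 𝒞, hclq, -, -, -, hcyc⟩ := h
    obtain ⟨C, hC, hfC⟩ := hcyc _ (by omega) f
    obtain ⟨j0, hj0⟩ := hf 0 (by omega)
    obtain ⟨j2, hj2⟩ := hf 2 (by omega)
    exact h02 ((hclq C hC).isClique (hj0 ▸ hfC j0) (hj2 ▸ hfC j2) hne02)

theorem IsTreelike.extends [Finite V] (hH : IsTreelike n H) (hK : IsTreelike n K) :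
    Extends H K := by
  classical
  have : Fintype V := Fintype.ofFinite V
  have hWne : Nonempty W := hK.2.1.nonempty
  refine extends_of_exists_adj hH.2.1 fun A hA v hv hvA φ hφ => ?_
  obtain ⟨a, ha, hva⟩ := hvA
  let N : Finset V := Finset.univ.filter fun x => x ∈ A ∧ H.Adj v x
  have hN : ∀ x, x ∈ N ↔ x ∈ A ∧ H.Adj v x := fun x => by simp [N]
  have hclq : H.IsClique (insert v N : Set V) := by
    rw [SimpleGraph.isClique_insert]
    refine ⟨fun x hx y hy hxy => ?_, fun x hx _ => ((hN x).1 hx).2⟩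
    have hx' := (hN x).1 hx
    have hy' := (hN y).1 hy
    exact hH.adj_of_neighbours hA hv hx'.1 hy'.1 hxy hx'.2 hy'.2
  have hcard : N.card < n := by
    obtain ⟨C, hC, hsub⟩ := hH.exists_isNClique hclq ⟨v, Or.inl rfl⟩
    have h1 : insert v N ⊆ C := by
      intro x hx
      exact hsub (by simpa using hx)
    have h2 := Finset.card_le_card h1
    rw [Finset.card_insert_of_notMem (by rw [hN]; exact fun h => hv h.1), hC.card_eq] at h2
    omega
  obtain ⟨D, hD, hsub⟩ := hK.exists_isNClique (s := φ '' N) (by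
    rintro _ ⟨x, hx, rfl⟩ _ ⟨y, hy, rfl⟩ hxy
    exact hφ x ((hN x).1 hx).1 y ((hN y).1 hy).1
      (hclq (Or.inr hx) (Or.inr hy) (by rintro rfl; exact hxy rfl)))
    ⟨φ a, a, (hN a).2 ⟨ha, hva⟩, rfl⟩
  obtain ⟨w, hwD, hw⟩ : ∃ w ∈ D, w ∉ N.image φ := by
    by_contra! hcon
    have h1 := Finset.card_le_card (show D ⊆ N.image φ from hcon)
    have h2 := Finset.card_image_le (s := N) (f := φ)
    rw [hD.card_eq] at h1
    omega
  refine ⟨w, fun x hx hvx => hD.isClique hwD (hsub ⟨x, (hN x).2 ⟨hx, hvx⟩, rfl⟩) ?_⟩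
  rintro rfl
  exact hw (Finset.mem_image_of_mem _ ((hN x).2 ⟨hx, hvx⟩))

end Treelike

/-! ### Non-bipartite components are treelike -/

section NonBipartite

variable {V : Type u} {W : Type v} {H : SimpleGraph V} {K : SimpleGraph W} {n : ℕ}

/-- `col` is a proper colouring of `G` with two colours. -/
def IsTwoColouring (G : SimpleGraph V) (col : V → Bool) : Prop :=
  ∀ a b, G.Adj a b → col a ≠ col b

/-- A maximal connected two-colourable induced subgraph has an outside vertex `w` that sees both
colours. Folding the subgraph onto an edge of `K` by colour makes the image of `w` the apex of a
triangle. -/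
theorem Extends.exists_triangle [Finite V] [Nontrivial W] (h : Extends H K) (hH : H.Connected)
    (hK : K.Connected) (hcol : ∀ col, ¬ IsTwoColouring H col) :
    ∃ a b c, K.Adj a b ∧ K.Adj c a ∧ K.Adj c b := by
  classical
  obtain ⟨o⟩ := hH.nonempty
  obtain ⟨u⟩ := hK.nonempty
  obtain ⟨u', huu'⟩ := hK.preconnected.exists_adj_of_nontrivial u
  obtain ⟨A, ⟨hA, col, hAcol⟩, hmax⟩ := Set.Finite.exists_maximal
    (s := {A : Set V | (H.induce A).Connected ∧
      ∃ col : V → Bool, HomOn H (⊤ : SimpleGraph Bool) A col}) (Set.toFinite _)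
    ⟨{o}, connected_induce_singleton o, fun _ => true,
      by rintro x rfl y rfl hxy; exact (H.loopless.irrefl _ hxy).elim⟩
  obtain ⟨⟨x, hx⟩⟩ := hA.nonempty
  obtain ⟨y, hy⟩ : ∃ y, y ∉ A := by
    by_contra! hall
    exact hcol col fun a b hab => hAcol a (hall a) b (hall b) hab
  obtain ⟨a, w, ha, hw, haw⟩ := exists_boundary_adj' hH hx hy
  obtain ⟨b, hb, hwb, hab⟩ : ∃ b ∈ A, H.Adj w b ∧ col b ≠ col a := by
    by_contra! hall
    refine hw (hmax (y := insert w A) ⟨connected_induce_insert hA ha haw.symm,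
      Function.update col w (!col a), hAcol.insert hw fun b hb hwb => ?_⟩
      (Set.subset_insert _ _) (Set.mem_insert _ _))
    rw [hall b hb hwb]
    simp
  obtain ⟨z, hz⟩ := h.exists_adj hA (φ := fun x => if col x = true then u else u') (by
    intro p hp q hq hpq
    have := hAcol p hp q hq hpq
    rw [SimpleGraph.top_adj] at this
    cases hcp : col p <;> cases hcq : col q <;> simp_all [huu'.symm]) w
  have h1 := hz a ha haw.symm
  have h2 := hz b hb hwb
  cases hca : col a <;> cases hcb : col b <;> simp_all only [ne_eq, not_true_eq_false, if_true,
    Bool.false_eq_true, if_false]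
  · exact ⟨u', u, z, huu'.symm, h1, h2⟩
  · exact ⟨u, u', z, huu', h1, h2⟩

theorem connected_induce_of_isClique {s : Set V} (hs : H.IsClique s) (hne : s.Nonempty) :
    (H.induce s).Connected := by
  obtain ⟨a, ha⟩ := hne
  have := connected_induce_union (B := s \ {a}) (connected_induce_singleton (G := H) a)
    fun b hb => ⟨a, rfl, hs hb.1 ha hb.2⟩
  rwa [Set.union_sdiff_self, Set.union_eq_right.2 (by simpa using ha)] at this

theorem isNClique_image_hom [DecidableEq W] {C : Finset V} (hC : H.IsNClique n C)
    (ψ : H →g K) : K.IsNClique n (C.image ψ) := by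
  have hadj : ∀ x ∈ C, ∀ y ∈ C, x ≠ y → K.Adj (ψ x) (ψ y) := fun x hx y hy hxy =>
    ψ.map_adj (hC.isClique hx hy hxy)
  refine ⟨?_, ?_⟩
  · intro x hx y hy hxy
    simp only [Finset.coe_image, Set.mem_image, Finset.mem_coe] at hx hy
    obtain ⟨x, hx, rfl⟩ := hx
    obtain ⟨y, hy, rfl⟩ := hy
    exact hadj x hx y hy (by rintro rfl; exact hxy rfl)
  · rw [Finset.card_image_of_injOn, hC.card_eq]
    intro x hx y hy hxy
    by_contra hne
    exact (hadj x hx y hy hne).ne hxy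

/-- A bijection onto `s` from a subset of `C` is a homomorphism; extending it carries `C` to an
`n`-clique containing `s`. -/
theorem Extends.exists_isNClique_superset (h : Extends H H) {C : Finset V}
    (hC : H.IsNClique n C) (hfree : H.CliqueFree (n + 1)) {s : Finset V} (hs : H.IsClique s)
    (hne : s.Nonempty) : ∃ D : Finset V, H.IsNClique n D ∧ s ⊆ D := by
  classical
  have hle : s.card ≤ C.card := by
    by_contra! hlt
    obtain ⟨t, hts, ht⟩ := Finset.exists_subset_card_eq (s := s) (n := n + 1)
      (by rw [hC.card_eq] at hlt; omega)
    exact hfree t ⟨hs.subset hts, ht⟩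
  obtain ⟨C', hC'C, hC'⟩ := Finset.exists_subset_card_eq hle
  let e : C' ≃ s := Finset.equivOfCardEq hC'
  obtain ⟨o, ho⟩ := hne
  have hC'ne : (C' : Set V).Nonempty := ⟨e.symm ⟨o, ho⟩, (e.symm ⟨o, ho⟩).2⟩
  obtain ⟨ψ, hψ⟩ := h.exists_hom
    (connected_induce_of_isClique (hC.isClique.subset hC'C) hC'ne)
    (φ := fun x => if hx : x ∈ C' then e ⟨x, hx⟩ else o) (by
      intro a ha b hb hab
      simp only [Finset.mem_coe] at ha hb
      simp only [dif_pos ha, dif_pos hb]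
      refine hs (e ⟨a, ha⟩).2 (e ⟨b, hb⟩).2 fun heq => hab.ne ?_
      simpa using e.injective (Subtype.ext heq))
  refine ⟨C.image ψ, isNClique_image_hom hC ψ, fun x hx => ?_⟩
  rw [Finset.mem_image]
  refine ⟨e.symm ⟨x, hx⟩, hC'C (e.symm ⟨x, hx⟩).2, ?_⟩
  rw [hψ _ (e.symm ⟨x, hx⟩).2, dif_pos (e.symm ⟨x, hx⟩).2]
  simp

theorem not_adj_all_of_cliqueFree {C : Finset V} (hC : H.IsNClique n C)
    (hfree : H.CliqueFree (n + 1)) (z : V) (hz : ∀ c ∈ C, H.Adj z c) : False := by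
  classical
  exact hfree _ (hC.insert hz)

/-- If `b ≠ b'`, fix `C` without `b` and send `v` to `b`. The image of `b` under an extension would
be adjacent to all of `C`, giving an `(n + 1)`-clique. -/
theorem Extends.eq_of_adj_isNClique (h : Extends H H) {C : Finset V} (hC : H.IsNClique n C)
    (hfree : H.CliqueFree (n + 1)) {v b b' : V} (hv : v ∉ C) (hb : b ∈ C) (hb' : b' ∈ C)
    (hvb : H.Adj v b) (hvb' : H.Adj v b') : b = b' := by
  classical
  by_contra hne
  have hconn : (H.induce ((C : Set V) \ {b})).Connected :=
    connected_induce_of_isClique (hC.isClique.subset Set.sdiff_subset)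
      ⟨b', hb', fun h => hne h.symm⟩
  have hv' : v ∉ (C : Set V) \ {b} := fun h => hv h.1
  obtain ⟨z, hz⟩ := h.exists_adj
    (connected_induce_insert hconn ⟨hb', fun h => hne h.symm⟩ hvb')
    (HomOn.insert (φ := id) (w := b) (fun _ _ _ _ h => h) hv'
      fun a ha _ => hC.isClique hb ha.1 fun h => ha.2 h.symm) b
  refine not_adj_all_of_cliqueFree hC hfree z fun c hc => ?_
  by_cases hcb : c = b
  · have := hz v (Or.inl rfl) hvb.symm
    rwa [Function.update_self, ← hcb] at this
  · have := hz c (Or.inr ⟨hc, hcb⟩) (hC.isClique hb hc fun h => hcb h.symm)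
    rwa [Function.update_of_ne (by rintro rfl; exact hv hc)] at this

/-- Take an `n`-clique `C` through `p₀` and `p₁`, with a third vertex `c`. Fix `C` without `p₀` and
send `p₂` to `c` and `p₃` to `p₀`; the only neighbours of `p₂` and `p₃` in `C` are `p₁` and `p₀`.
The image of `p₀` would be adjacent to all of `C`. -/
theorem Extends.not_square (h : Extends H H) {C₀ : Finset V} (hC₀ : H.IsNClique n C₀)
    (hfree : H.CliqueFree (n + 1)) (hn : 3 ≤ n) {p₀ p₁ p₂ p₃ : V} (h01 : H.Adj p₀ p₁)
    (h12 : H.Adj p₁ p₂) (h23 : H.Adj p₂ p₃) (h30 : H.Adj p₃ p₀) (h02 : ¬ H.Adj p₀ p₂)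
    (hne02 : p₀ ≠ p₂) (hne13 : p₁ ≠ p₃) : False := by
  classical
  obtain ⟨C, hC, hsub⟩ := h.exists_isNClique_superset hC₀ hfree (s := {p₀, p₁})
    (by simpa using fun _ => h01) (by simp)
  have h0C : p₀ ∈ C := hsub (by simp)
  have h1C : p₁ ∈ C := hsub (by simp)
  have h2C : p₂ ∉ C := fun h => h02 (hC.isClique h0C h hne02)
  have huniq := fun {v b b'} => h.eq_of_adj_isNClique hC hfree (v := v) (b := b) (b' := b')
  have h3C : p₃ ∉ C := fun h => hne13 (huniq h2C h1C h h12.symm h23)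
  obtain ⟨c, hcC, hc0, hc1⟩ : ∃ c ∈ C, c ≠ p₀ ∧ c ≠ p₁ := by
    by_contra! hall
    have h1 : C ⊆ {p₀, p₁} := fun c hc => by
      by_cases hc0 : c = p₀
      · simp [hc0]
      · simp [hall c hc hc0]
    have h2 := (Finset.card_le_card h1).trans Finset.card_le_two
    rw [hC.card_eq] at h2
    omega
  have hconn : (H.induce ((C : Set V) \ {p₀})).Connected :=
    connected_induce_of_isClique (hC.isClique.subset Set.sdiff_subset) ⟨p₁, h1C, h01.ne'⟩
  have hconn2 := connected_induce_insert hconn ⟨h1C, h01.ne'⟩ h12.symm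
  have hconn3 := connected_induce_insert hconn2 (Or.inl rfl) h23.symm
  have hhom : HomOn H H ((C : Set V) \ {p₀}) id := fun _ _ _ _ h => h
  have hhom2 := hhom.insert (x := p₂) (w := c) (fun h => h2C h.1) fun a ha h2a => by
    rw [huniq h2C ha.1 h1C h2a h12.symm]
    exact hC.isClique hcC h1C hc1
  have hhom3 := hhom2.insert (x := p₃) (w := p₀)
    (by rintro (h | h); exacts [h23.ne h.symm, h3C h.1]) fun a ha h3a => by
      rcases ha with rfl | ha
      · rw [Function.update_self]
        exact hC.isClique h0C hcC hc0.symm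
      · exact (ha.2 (huniq h3C ha.1 h0C h3a h30)).elim
  obtain ⟨z, hz⟩ := h.exists_adj hconn3 hhom3 p₀
  refine not_adj_all_of_cliqueFree hC hfree z fun x hx => ?_
  by_cases hx0 : x = p₀
  · have := hz p₃ (Or.inl rfl) h30.symm
    rwa [Function.update_self, ← hx0] at this
  · have := hz x (Or.inr (Or.inr ⟨hx, hx0⟩)) (hC.isClique h0C hx fun h => hx0 h.symm)
    rwa [Function.update_of_ne (by rintro rfl; exact h3C hx),
      Function.update_of_ne (by rintro rfl; exact h2C hx)] at this

/-- The folding used for squares, with `p₂`, `p₃`, `p₄` sent to `c`, `p₁`, `p₀`: again the image of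
`p₀` would complete an `(n + 1)`-clique. -/
theorem Extends.not_pentagon (h : Extends H H) {C₀ : Finset V} (hC₀ : H.IsNClique n C₀)
    (hfree : H.CliqueFree (n + 1)) (hn : 3 ≤ n) {p₀ p₁ p₂ p₃ p₄ : V} (h01 : H.Adj p₀ p₁)
    (h12 : H.Adj p₁ p₂) (h23 : H.Adj p₂ p₃) (h34 : H.Adj p₃ p₄) (h40 : H.Adj p₄ p₀)
    (h02 : ¬ H.Adj p₀ p₂) (h03 : ¬ H.Adj p₀ p₃) (h13 : ¬ H.Adj p₁ p₃) (h14 : ¬ H.Adj p₁ p₄) :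
    False := by
  classical
  obtain ⟨C, hC, hsub⟩ := h.exists_isNClique_superset hC₀ hfree (s := {p₀, p₁})
    (by simpa using fun _ => h01) (by simp)
  have h0C : p₀ ∈ C := hsub (by simp)
  have h1C : p₁ ∈ C := hsub (by simp)
  have h2C : p₂ ∉ C := fun h => h02 (hC.isClique h0C h (by rintro rfl; exact h03 h23))
  have h3C : p₃ ∉ C := fun h => h03 (hC.isClique h0C h (by rintro rfl; exact h13 h01.symm))
  have h4C : p₄ ∉ C := fun h => h14 (hC.isClique h1C h (by rintro rfl; exact h13 h34.symm))
  have huniq := fun {v b b'} => h.eq_of_adj_isNClique hC hfree (v := v) (b := b) (b' := b')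
  obtain ⟨c, hcC, hc0, hc1⟩ : ∃ c ∈ C, c ≠ p₀ ∧ c ≠ p₁ := by
    by_contra! hall
    have h1 : C ⊆ {p₀, p₁} := fun c hc => by
      by_cases hc0 : c = p₀
      · simp [hc0]
      · simp [hall c hc hc0]
    have h2 := (Finset.card_le_card h1).trans Finset.card_le_two
    rw [hC.card_eq] at h2
    omega
  have hconn : (H.induce ((C : Set V) \ {p₀})).Connected :=
    connected_induce_of_isClique (hC.isClique.subset Set.sdiff_subset) ⟨p₁, h1C, h01.ne'⟩
  have hconn2 := connected_induce_insert hconn ⟨h1C, h01.ne'⟩ h12.symm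
  have hconn3 := connected_induce_insert hconn2 (Or.inl rfl) h23.symm
  have hconn4 := connected_induce_insert hconn3 (Or.inl rfl) h34.symm
  have hhom : HomOn H H ((C : Set V) \ {p₀}) id := fun _ _ _ _ h => h
  have hhom2 := hhom.insert (x := p₂) (w := c) (fun h => h2C h.1) fun a ha h2a => by
    rw [huniq h2C ha.1 h1C h2a h12.symm]
    exact hC.isClique hcC h1C hc1
  have hhom3 := hhom2.insert (x := p₃) (w := p₁)
    (by rintro (h | h); exacts [h23.ne h.symm, h3C h.1]) fun a ha h3a => by
      rcases ha with rfl | ha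
      · rw [Function.update_self]
        exact hC.isClique h1C hcC hc1.symm
      · rw [Function.update_of_ne (by rintro rfl; exact h2C ha.1)]
        exact hC.isClique h1C ha.1 (by rintro rfl; exact h13 h3a.symm)
  have h24 : p₄ ≠ p₂ := by rintro rfl; exact h02 h40.symm
  have hhom4 := hhom3.insert (x := p₄) (w := p₀)
    (by rintro (h | h | h); exacts [h34.ne h.symm, h24 h, h4C h.1]) fun a ha h4a => by
      rcases ha with rfl | rfl | ha
      · rw [Function.update_self]
        exact h01
      · rw [Function.update_of_ne h23.ne, Function.update_self]
        exact hC.isClique h0C hcC hc0.symm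
      · exact (ha.2 (huniq h4C ha.1 h0C h4a h40)).elim
  obtain ⟨z, hz⟩ := h.exists_adj hconn4 hhom4 p₀
  refine not_adj_all_of_cliqueFree hC hfree z fun x hx => ?_
  by_cases hx0 : x = p₀
  · have := hz p₄ (Or.inl rfl) h40.symm
    rwa [Function.update_self, ← hx0] at this
  · have := hz x (Or.inr (Or.inr (Or.inr ⟨hx, hx0⟩))) (hC.isClique h0C hx fun h => hx0 h.symm)
    rwa [Function.update_of_ne (by rintro rfl; exact h4C hx),
      Function.update_of_ne (by rintro rfl; exact h3C hx),
      Function.update_of_ne (by rintro rfl; exact h2C hx)] at this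

theorem exists_walk_length_add_two {a b a' : V} (ha : H.Adj a a') {l : ℕ}
    (h : ∃ p : H.Walk a b, p.length = l) (m : ℕ) : ∃ p : H.Walk a b, p.length = l + 2 * m := by
  induction m with
  | zero => exact h
  | succ m ih =>
    obtain ⟨p, hp⟩ := ih
    exact ⟨.cons ha (.cons ha.symm p), by simp [hp]; omega⟩

theorem Extends.isTreelike (h : Extends H H) (hH : H.Connected) [Nontrivial V] {C₀ : Finset V}
    (hC₀ : H.IsNClique n C₀) (hfree : H.CliqueFree (n + 1)) (hn : 3 ≤ n) : IsTreelike n H := by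
  classical
  have hsup := fun {s} => h.exists_isNClique_superset hC₀ hfree (s := s)
  refine ⟨by omega, hH, {C | H.IsNClique n C}, fun C hC => hC, fun v => ?_, fun u v huv => ?_,
    fun C hC D hD hCD => ?_, fun k hk f => ?_⟩
  · obtain ⟨D, hD, hvD⟩ := hsup (s := {v}) (by simp) (by simp)
    exact ⟨D, hD, hvD (by simp)⟩
  · obtain ⟨D, hD, hvD⟩ := hsup (s := {u, v}) (by simpa using fun _ => huv) (by simp)
    exact ⟨D, hD, hvD (by simp), hvD (by simp)⟩
  · intro x hx y hy
    by_contra hxy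
    obtain ⟨v, hvD, hvC⟩ : ∃ v ∈ D, v ∉ C := by
      by_contra! hsub
      refine hCD (Finset.eq_of_subset_of_card_le hsub ?_).symm
      rw [hC.card_eq, hD.card_eq]
    exact hxy (h.eq_of_adj_isNClique hC hfree hvC hx.1 hy.1
      (hD.isClique hvD hx.2 (by rintro rfl; exact hvC hx.1))
      (hD.isClique hvD hy.2 (by rintro rfl; exact hvC hy.1)))
  · rcases hk.lt_or_eq with hk4 | rfl
    · exfalso
      obtain ⟨q, v, hq, hvq, hv0, hvl⟩ := exists_inducedPath_of_cycle hk4 f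
      have hadj : ∀ i, i + 1 ≤ k - 2 → H.Adj (q i) (q (i + 1)) := fun i hi =>
        (hq.adj_iff (by omega) hi).2 (Or.inl rfl)
      have hnadj : ∀ i j, i + 1 < j → j ≤ k - 2 → ¬ H.Adj (q i) (q j) := fun i j hij hj => by
        rw [hq.adj_iff (by omega) hj]; omega
      have hne : ∀ i j, i < j → j ≤ k - 2 → q i ≠ q j := fun i j hij hj => (hq i j hij hj).1
      rcases eq_or_lt_of_le (show 4 ≤ k from hk4) with rfl | hk5
      · exact h.not_square hC₀ hfree hn (hadj 0 (by omega)) (hadj 1 (by omega)) hvl.symm hv0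
          (hnadj 0 2 (by omega) (by omega)) (hne 0 2 (by omega) (by omega))
          (hvq 1 (by omega)).symm
      have a01 := hadj 0 (by omega)
      have a12 := hadj 1 (by omega)
      have a23 := hadj 2 (by omega)
      have n02 := hnadj 0 2 (by omega) (by omega)
      have n03 := hnadj 0 3 (by omega) (by omega)
      have n13 := hnadj 1 3 (by omega) (by omega)
      -- The induced path has length `k - 2`. A walk from `q 0` to `q 3` of that length starts from
      -- one of length 3, or of length 4 through a triangle on the first edge, according to parity,
      -- and is padded by steps back and forth.
      have hw : ∃ p : H.Walk (q 0) (q 3), p.length = k - 2 := by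
        have h3 : ∃ p : H.Walk (q 0) (q 3), p.length = 3 :=
          ⟨.cons a01 (.cons a12 (.cons a23 .nil)), rfl⟩
        have h4 : ∃ p : H.Walk (q 0) (q 3), p.length = 4 := by
          obtain ⟨C, hC, hsub⟩ := hsup (s := {q 0, q 1}) (by simpa using fun _ => a01) (by simp)
          obtain ⟨c, hcC, hc⟩ : ∃ c ∈ C, c ∉ ({q 0, q 1} : Finset V) := by
            by_contra! hall
            have h2 := (Finset.card_le_card (show C ⊆ _ from hall)).trans Finset.card_le_two
            rw [hC.card_eq] at h2
            omega
          simp only [Finset.mem_insert, Finset.mem_singleton, not_or] at hc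
          exact ⟨.cons (hC.isClique (hsub (by simp)) hcC (Ne.symm hc.1))
            (.cons (hC.isClique hcC (hsub (by simp)) hc.2) (.cons a12 (.cons a23 .nil))), rfl⟩
        rcases Nat.even_or_odd' (k - 5) with ⟨m, hm | hm⟩
        · obtain ⟨p, hp⟩ := exists_walk_length_add_two a01 h3 m
          exact ⟨p, by omega⟩
        · obtain ⟨p, hp⟩ := exists_walk_length_add_two a01 h4 m
          exact ⟨p, by omega⟩
      obtain ⟨p, hp⟩ := hw
      obtain ⟨z, hz0, hz3⟩ := h.exists_common_adj_of_walk hq hv0 hvl p hp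
      have hz1 : z ≠ q 1 := by rintro rfl; exact n13 hz3
      have hz2 : z ≠ q 2 := by rintro rfl; exact n02 hz0.symm
      -- The 5-cycle z, q 0, q 1, q 2, q 3 can only have chords at `z`. No chord gives a pentagon,
      -- one a square, and two a vertex `q 2` with two neighbours in a clique not containing it.
      by_cases hzq1 : H.Adj z (q 1)
      · by_cases hzq2 : H.Adj z (q 2)
        · obtain ⟨C, hC, hsub⟩ := hsup (s := {z, q 0, q 1}) (by
            simp only [Finset.coe_insert, Finset.coe_singleton, SimpleGraph.isClique_insert,
              SimpleGraph.isClique_singleton, Set.mem_insert_iff, Set.mem_singleton_iff,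
              forall_eq_or_imp, forall_eq, true_and]
            exact ⟨fun _ => a01, fun _ => hz0, fun _ => hzq1⟩) (by simp)
          have h2C : q 2 ∉ C := fun h2 => n02 (hC.isClique (hsub (by simp)) h2
            (hne 0 2 (by omega) (by omega)))
          exact hz1 (h.eq_of_adj_isNClique hC hfree h2C (hsub (by simp)) (hsub (by simp))
            hzq2.symm a12.symm)
        · exact h.not_square hC₀ hfree hn hzq1 a12 a23 hz3.symm hzq2 hz2
            (hne 1 3 (by omega) (by omega))
      · by_cases hzq2 : H.Adj z (q 2)
        · exact h.not_square hC₀ hfree hn hzq2 a12.symm a01.symm hz0.symm hzq1 hz1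
            (hne 0 2 (by omega) (by omega)).symm
        · exact h.not_pentagon hC₀ hfree hn hz0 a01 a12 a23 hz3.symm hzq1 hzq2 n02 n03
    · obtain ⟨D, hD, hsub⟩ := hsup (s := Finset.univ.image f) (by
        intro x hx y hy hxy
        simp only [Finset.coe_image, Finset.coe_univ, Set.image_univ, Set.mem_range] at hx hy
        obtain ⟨i, rfl⟩ := hx
        obtain ⟨j, rfl⟩ := hy
        rw [f.map_adj_iff, SimpleGraph.cycleGraph_three_eq_top, SimpleGraph.top_adj]
        rintro rfl
        exact hxy rfl) ⟨f 0, by simp⟩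
      exact ⟨D, hD, fun i => hsub (by simp)⟩

end NonBipartite

/-! ### Two-colourings and sufficiency of (d) -/

section Colourings

variable {V : Type u} {W : Type v} {G H : SimpleGraph V} {K : SimpleGraph W} {n : ℕ}

theorem IsTwoColouring.ne_of_adj {col : V → Bool} (h : IsTwoColouring G col) {a b : V}
    (hab : G.Adj a b) : col b = !col a := by
  have := h a b hab
  cases ha : col a <;> cases hb : col b <;> simp_all

theorem IsTwoColouring.not_adj {col : V → Bool} (h : IsTwoColouring G col) {a b : V}
    (hab : col a = col b) : ¬ G.Adj a b := fun h' => h a b h' hab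

theorem IsBipartition.exists_colouring {X Y : Set V} (h : IsBipartition G X Y) :
    ∃ col, IsTwoColouring G col ∧ (∀ x, x ∈ X ↔ col x = true) ∧ (∀ x, x ∈ Y ↔ col x = false) := by
  classical
  obtain ⟨h1, h2⟩ := h
  have hY : ∀ x, x ∈ Y ↔ x ∉ X := fun x =>
    ⟨fun hy hx => Set.disjoint_left.1 h1.disjoint hx hy, fun hx =>
      ((h2 ▸ Set.mem_univ x : x ∈ X ∪ Y)).resolve_left hx⟩
  refine ⟨fun x => decide (x ∈ X), fun a b hab => ?_, by simp, by simpa using hY⟩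
  rcases h1.mem_of_adj hab with ⟨ha, hb⟩ | ⟨ha, hb⟩
  · have := (hY b).1 hb
    simp [ha, this]
  · have := (hY a).1 ha
    simp [hb, this]

theorem IsTwoColouring.isBipartition {col : V → Bool} (h : IsTwoColouring G col) (p : Bool) :
    IsBipartition G {x | col x = p} {x | col x = !p} := by
  refine ⟨⟨?_, ?_⟩, ?_⟩
  · rw [Set.disjoint_left]
    intro x hx hy
    simp only [Set.mem_ofPred_eq] at hx hy
    rw [hx] at hy
    simp at hy
  · intro a b hab
    have := h.ne_of_adj hab
    simp only [Set.mem_ofPred_eq]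
    cases p <;> cases ha : col a <;> simp_all
  · ext x
    simp only [Set.mem_union, Set.mem_ofPred_eq, Set.mem_univ, iff_true]
    cases p <;> cases col x <;> simp

theorem partsHaveCommonNeighbour_iff : PartsHaveCommonNeighbour G ↔
    ∃ col, IsTwoColouring G col ∧ ∀ p, ∃ v, ∀ x, col x = p → G.Adj v x := by
  constructor
  · rintro ⟨X, Y, h, ⟨v, hv⟩, ⟨v', hv'⟩⟩
    obtain ⟨col, hcol, hX, hY⟩ := h.exists_colouring
    refine ⟨col, hcol, fun p => ?_⟩
    cases p
    · exact ⟨v', fun x hx => hv' x ((hY x).2 hx)⟩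
    · exact ⟨v, fun x hx => hv x ((hX x).2 hx)⟩
  · rintro ⟨col, hcol, h⟩
    exact ⟨_, _, hcol.isBipartition true, h true, h false⟩

theorem eq_of_connected_of_adj {A : Set V} (hA : (H.induce A).Connected) {f : V → Bool}
    (hf : ∀ a ∈ A, ∀ b ∈ A, H.Adj a b → f a = f b) {a b : V} (ha : a ∈ A) (hb : b ∈ A) :
    f a = f b := by
  by_contra hne
  obtain ⟨x, y, hx, hxU, hy, hyU, hxy⟩ := exists_boundary_adj hA (U := {x | f x = f a}) ha rfl hb
    (fun h => hne h.symm)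
  exact hyU ((hf x hx y hy hxy).symm.trans hxU)

/-- On a connected domain a homomorphism of bipartite graphs either preserves or exchanges the
colours throughout: the xor of the two colours is constant along edges. -/
theorem HomOn.colour_eq {A : Set V} (hA : (H.induce A).Connected) {φ : V → W}
    (hφ : HomOn H K A φ) {col : V → Bool} {col' : W → Bool} (hcol : IsTwoColouring H col)
    (hcol' : IsTwoColouring K col') {a b : V} (ha : a ∈ A) (hb : b ∈ A) (hab : col a = col b) :
    col' (φ a) = col' (φ b) := by
  have := eq_of_connected_of_adj hA (f := fun x => xor (col x) (col' (φ x))) (by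
    intro x hx y hy hxy
    have h1 := hcol.ne_of_adj hxy
    have h2 := hcol'.ne_of_adj (hφ x hx y hy hxy)
    simp [h1, h2]) ha hb
  simpa [hab] using this

theorem extends_of_partsHaveCommonNeighbour [Finite V] (hH : H.Connected) {col : V → Bool}
    (hcol : IsTwoColouring H col) (hK : PartsHaveCommonNeighbour K) : Extends H K := by
  obtain ⟨col', hcol', hcn⟩ := partsHaveCommonNeighbour_iff.1 hK
  have : Nonempty W := ⟨(hcn true).choose⟩
  refine extends_of_exists_adj hH fun A hA v hv hvA φ hφ => ?_
  obtain ⟨a, ha, hva⟩ := hvA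
  obtain ⟨w, hw⟩ := hcn (col' (φ a))
  refine ⟨w, fun b hb hvb => hw _ (hφ.colour_eq hA hcol hcol' hb ha ?_)⟩
  rw [hcol.ne_of_adj hva, hcol.ne_of_adj hvb]

end Colourings

/-! ### Finding PCM(n) graphs -/

section PCM

variable {V : Type u} {G : SimpleGraph V} {n : ℕ}

theorem isPCM_induce_union [Finite V] {col : V → Bool} (hcol : IsTwoColouring G col) {p : Bool}
    {T Y : Set V} (hT : ∀ x ∈ T, col x = p) (hY : ∀ y ∈ Y, col y = !p)
    (hconn : (G.induce (T ∪ Y)).Connected) (h2 : 2 ≤ T.ncard) (hn : Y.ncard = n) {f : V → V}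
    (hmaps : Set.MapsTo f T Y) (hinj : Set.InjOn f T) (hf : ∀ x ∈ T, ¬ G.Adj x (f x)) :
    IsPCM n (G.induce (T ∪ Y)) := by
  classical
  have hTY : ∀ x, x ∈ T → x ∉ Y := fun x h3 h4 => by
    have := hT x h3
    have := hY x h4
    simp_all
  have hcT : (Subtype.val ⁻¹' T : Set ↥(T ∪ Y)).ncard = T.ncard :=
    Set.ncard_preimage_of_injective_subset_range Subtype.val_injective
      (by rw [Subtype.range_coe]; exact Set.subset_union_left)
  have hcY : (Subtype.val ⁻¹' Y : Set ↥(T ∪ Y)).ncard = Y.ncard :=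
    Set.ncard_preimage_of_injective_subset_range Subtype.val_injective
      (by rw [Subtype.range_coe]; exact Set.subset_union_right)
  refine ⟨hconn, Subtype.val ⁻¹' T, Subtype.val ⁻¹' Y, ⟨⟨?_, ?_⟩, ?_⟩, by rwa [hcT], ?_,
    by rw [hcY, hn], fun z => if hz : z.1 ∈ T then ⟨f z, Or.inr (hmaps hz)⟩ else z, ?_, ?_, ?_⟩
  · rw [Set.disjoint_left]
    exact fun x => hTY x
  · rintro ⟨a, ha⟩ ⟨b, hb⟩ hab
    have h3 := hcol a b hab
    rcases ha with ha | ha <;> rcases hb with hb | hb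
    · exact (h3 ((hT a ha).trans (hT b hb).symm)).elim
    · exact Or.inl ⟨ha, hb⟩
    · exact Or.inr ⟨ha, hb⟩
    · exact (h3 ((hY a ha).trans (hY b hb).symm)).elim
  · ext ⟨x, hx⟩
    simpa using hx
  · rw [hcT, hcY]
    exact Set.ncard_le_ncard_of_injOn f hmaps hinj
  · intro z hz
    have hz' : z.1 ∈ T := hz
    simp only [dif_pos hz']
    exact hmaps hz
  · intro z hz y hy hzy
    have hz' : z.1 ∈ T := hz
    have hy' : y.1 ∈ T := hy
    simp only [dif_pos hz', dif_pos hy'] at hzy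
    exact Subtype.ext (hinj hz hy (congrArg Subtype.val hzy))
  · intro z hz hadj
    have hz' : z.1 ∈ T := hz
    simp only [dif_pos hz'] at hadj
    exact hf z hz hadj

/-- The vertices of `A` with a neighbour in `T`. -/
def nbrsIn (G : SimpleGraph V) (A T : Set V) : Set V := {y | y ∈ A ∧ ∃ x ∈ T, G.Adj x y}

/-- The last step of the construction in `exists_isPCM`. The complement matching sends `x'` to `y₁`,
the still unmatched `l` to the new vertex `y'`, and the rest of `T` by `g`. It is injective because
`g` avoids the neighbours of `x₁` while `y₁` is one of them. The target side is padded to size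
exactly `n`. -/
theorem exists_isPCM_of_extension [Finite V] {col : V → Bool} (hcol : IsTwoColouring G col)
    {p : Bool} {A T Z : Set V} {x₁ l x' y₀ y' y₁ : V} {g : V → V} (hTp : ∀ x ∈ T, col x = p)
    (hx₁ : x₁ ∈ T) (hZ : Z ⊆ nbrsIn G A T) (hconn : (G.induce (T ∪ Z)).Connected)
    (hZn : Z.ncard < n) (hx'p : col x' = p) (hx'T : x' ∉ T)
    (hy₀ : y₀ ∈ Z) (hx'y₀ : G.Adj x' y₀) (hy'A : y' ∈ A) (hx'y' : G.Adj x' y')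
    (hy' : y' ∉ nbrsIn G A T)
    (hg : ∀ x ∈ T, x ≠ l → g x ∈ Z ∧ ¬ G.Adj x (g x) ∧ ¬ G.Adj x₁ (g x))
    (hginj : Set.InjOn g (T \ {l})) (hy₁ : y₁ ∈ Z) (hxy₁ : G.Adj x₁ y₁) (hx'y₁ : ¬ G.Adj x' y₁)
    (hn : n ≤ (nbrsIn G A (insert x' T)).ncard) : ∃ S : Set V, IsPCM n (G.induce S) := by
  classical
  have hy'Z : y' ∉ Z := fun h => hy' (hZ h)
  have hTy' : ∀ x ∈ T, ¬ G.Adj x y' := fun x hx h => hy' ⟨hy'A, x, hx, h⟩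
  have hsub : insert y' Z ⊆ nbrsIn G A (insert x' T) := by
    rintro y (rfl | hy)
    · exact ⟨hy'A, x', Or.inl rfl, hx'y'⟩
    · obtain ⟨h1, x, h2, h3⟩ := hZ hy
      exact ⟨h1, x, Or.inr h2, h3⟩
  obtain ⟨Y, hY1, hY2, hY3⟩ := Set.exists_subsuperset_card_eq hsub
    ((Set.ncard_insert_le _ _).trans hZn) hn
  have hfx' : ∀ x ∈ T, x ≠ x' := fun x hx h => hx'T (h ▸ hx)
  refine ⟨insert x' T ∪ Y, isPCM_induce_union hcol (p := p)
    (f := fun x => if x = x' then y₁ else if x = l then y' else g x) ?_ ?_ ?_ ?_ hY3 ?_ ?_ ?_⟩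
  · rintro x (rfl | hx)
    · exact hx'p
    · exact hTp x hx
  · intro y hy
    obtain ⟨-, x, hx, hxy⟩ := hY2 hy
    rw [hcol.ne_of_adj hxy]
    rcases hx with rfl | hx
    · rw [hx'p]
    · rw [hTp x hx]
  · have h1 := connected_induce_union (B := Y)
      (connected_induce_insert hconn (Or.inr hy₀) hx'y₀) (by
        intro y hy
        obtain ⟨-, x, hx, hxy⟩ := hY2 hy
        rcases hx with rfl | hx
        · exact ⟨x, Or.inl rfl, hxy.symm⟩
        · exact ⟨x, Or.inr (Or.inl hx), hxy.symm⟩)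
    have h2 : insert x' (T ∪ Z) ∪ Y = insert x' T ∪ Y := by
      have : Z ⊆ Y := (Set.subset_insert _ _).trans hY1
      rw [Set.insert_union, Set.insert_union, Set.union_assoc, Set.union_eq_right.2 this]
    rwa [h2] at h1
  · have : ({x', x₁} : Set V) ⊆ insert x' T := by
      rintro x (rfl | rfl)
      · exact Or.inl rfl
      · exact Or.inr hx₁
    rw [← Set.ncard_pair (hfx' x₁ hx₁).symm]
    exact Set.ncard_le_ncard this (Set.toFinite _)
  · intro x hx
    by_cases h1 : x = x'
    · simp only [if_pos h1]
      exact hY1 (Or.inr hy₁)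
    · by_cases h2 : x = l
      · simp only [if_neg h1, if_pos h2]
        exact hY1 (Or.inl rfl)
      · simp only [if_neg h1, if_neg h2]
        exact hY1 (Or.inr (hg x (hx.resolve_left h1) h2).1)
  · have key : ∀ x ∈ T, (if x = l then y' else g x) ≠ y₁ := by
      intro x hx h
      by_cases h2 : x = l
      · rw [if_pos h2] at h
        exact hy'Z (h ▸ hy₁)
      · rw [if_neg h2] at h
        exact (hg x hx h2).2.2 (h ▸ hxy₁)
    intro x hx y hy hxy
    by_cases h1 : x = x' <;> by_cases h2 : y = x'
    · rw [h1, h2]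
    · simp only [if_pos h1, if_neg h2] at hxy
      exact (key y (hy.resolve_left h2) hxy.symm).elim
    · simp only [if_neg h1, if_pos h2] at hxy
      exact (key x (hx.resolve_left h1) hxy).elim
    · simp only [if_neg h1, if_neg h2] at hxy
      have hxT := hx.resolve_left h1
      have hyT := hy.resolve_left h2
      by_cases h3 : x = l <;> by_cases h4 : y = l
      · rw [h3, h4]
      · rw [if_pos h3, if_neg h4] at hxy
        exact (hy'Z (hxy ▸ (hg y hyT h4).1)).elim
      · rw [if_neg h3, if_pos h4] at hxy
        exact (hy'Z (hxy ▸ (hg x hxT h3).1)).elim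
      · rw [if_neg h3, if_neg h4] at hxy
        exact hginj ⟨hxT, h3⟩ ⟨hyT, h4⟩ hxy
  · intro x hx
    by_cases h1 : x = x'
    · simp only [if_pos h1]
      rw [h1]
      exact hx'y₁
    · have hxT := hx.resolve_left h1
      by_cases h2 : x = l
      · simp only [if_neg h1, if_pos h2]
        exact hTy' x hxT
      · simp only [if_neg h1, if_neg h2]
        exact (hg x hxT h2).2.1

/-- A connected bipartite induced subgraph one of whose parts has at least `n` vertices and no
common neighbour in the other part contains a `PCM(n)` graph. -/
theorem exists_isPCM [Finite V] {col : V → Bool} (hcol : IsTwoColouring G col) {p : Bool}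
    {A : Set V} (hA : (G.induce A).Connected) (hn : 3 ≤ n)
    (hcard : n ≤ {y | y ∈ A ∧ col y = !p}.ncard)
    (hmiss : ∀ x ∈ A, col x = p → ∃ y ∈ A, (col y = !p) ∧ ¬ G.Adj x y) :
    ∃ S : Set V, IsPCM n (G.induce S) := by
  classical
  have hnbr : ∀ T : Set V, (∀ x ∈ T, col x = p) → ∀ y ∈ nbrsIn G A T, col y = !p := by
    rintro T hT y ⟨-, x, hx, hxy⟩
    rw [hcol.ne_of_adj hxy, hT x hx]
  obtain ⟨y, hyA, hyp⟩ : {y | y ∈ A ∧ col y = !p}.Nonempty :=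
    (Set.ncard_pos (Set.toFinite _)).1 (by omega)
  obtain ⟨y', ⟨hy'A, hy'p⟩, hy'y⟩ :=
    Set.exists_ne_of_one_lt_ncard (s := {y | y ∈ A ∧ col y = !p}) (by omega) y
  obtain ⟨a, x, ha, hay, hx, -, hax⟩ := exists_boundary_adj hA (U := {y}) hyA rfl hy'A hy'y
  have hxp : col x = p := by
    rw [hcol.ne_of_adj hax, show a = y from hay, hyp, Bool.not_not]
  -- Maximal degree of `x₁` ensures that each later `x'`, having a neighbour outside that of `x₁`,
  -- also misses some neighbour of `x₁`; this `y₁` becomes the partner of `x'`.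
  obtain ⟨x₁, ⟨hx₁A, hx₁p⟩, hx₁⟩ := Set.exists_max_image {x | x ∈ A ∧ col x = p}
    (fun x => (nbrsIn G A {x}).ncard) (Set.toFinite _) ⟨x, hx, hxp⟩
  have hnext : ∀ T : Set V, (∀ x ∈ T, x ∈ A ∧ col x = p) → T.Nonempty →
      (∃ y ∈ A, (col y = !p) ∧ y ∉ nbrsIn G A T) →
      ∃ x' ∈ A, col x' = p ∧ x' ∉ T ∧ (∃ y₀ ∈ nbrsIn G A T, G.Adj x' y₀) ∧
        ∃ y' ∈ A, G.Adj x' y' ∧ y' ∉ nbrsIn G A T := by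
    rintro T hT ⟨t, ht⟩ ⟨y, hyA, hyp, hyT⟩
    -- An edge leaving this set must run from a neighbour of `T` to a vertex of colour `p` that has
    -- a further neighbour outside `nbrsIn G A T`.
    obtain ⟨a, b, ha, haU, hb, hbU, hab⟩ := exists_boundary_adj hA
      (U := {z | z ∈ nbrsIn G A T ∨ (col z = p ∧ ∀ y ∈ A, G.Adj z y → y ∈ nbrsIn G A T)})
      (hT t ht).1 (Or.inr ⟨(hT t ht).2, fun y hy hty => ⟨hy, t, ht, hty⟩⟩) hyA (by
        rintro (h | ⟨h, -⟩)
        · exact hyT h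
        · rw [hyp] at h
          simp at h)
    rcases haU with haU | ⟨-, haU⟩
    · have hbp : col b = p := by
        rw [hcol.ne_of_adj hab, hnbr T (fun x hx => (hT x hx).2) a haU, Bool.not_not]
      have hbU' : ¬ ∀ y ∈ A, G.Adj b y → y ∈ nbrsIn G A T := fun h => hbU (Or.inr ⟨hbp, h⟩)
      push Not at hbU'
      obtain ⟨y', hy', hby', hy'T⟩ := hbU'
      exact ⟨b, hb, hbp, fun hbT => hy'T ⟨hy', b, hbT, hby'⟩, ⟨a, haU, hab.symm⟩,
        y', hy', hby', hy'T⟩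
    · exact (hbU (Or.inl (haU b hb hab))).elim
  have hy₁ : ∀ x' ∈ A, col x' = p → ∀ y' ∈ A, G.Adj x' y' → ¬ G.Adj x₁ y' →
      ∃ y₁ ∈ A, G.Adj x₁ y₁ ∧ ¬ G.Adj x' y₁ := by
    intro x' hx' hx'p y' hy' hx'y' hx₁y'
    by_contra! hall
    have h1 : nbrsIn G A {x₁} ⊂ nbrsIn G A {x'} := by
      refine ⟨?_, fun hle => ?_⟩
      · rintro y ⟨hy, _, rfl, hxy⟩
        exact ⟨hy, x', rfl, hall y hy hxy⟩
      · obtain ⟨-, _, rfl, h⟩ := hle ⟨hy', x', rfl, hx'y'⟩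
        exact hx₁y' h
    have h2 := Set.ncard_lt_ncard h1 (Set.toFinite _)
    have h3 := hx₁ x' ⟨hx', hx'p⟩
    omega
  by_cases hbig : n ≤ (nbrsIn G A {x₁}).ncard
  · obtain ⟨x', hx'A, hx'p, hx'T, ⟨y₀, hy₀, hx'y₀⟩, y', hy'A, hx'y', hy'T⟩ :=
      hnext {x₁} (by rintro x rfl; exact ⟨hx₁A, hx₁p⟩) ⟨x₁, rfl⟩ (by
        obtain ⟨y, hy, hyp, hxy⟩ := hmiss x₁ hx₁A hx₁p
        exact ⟨y, hy, hyp, by rintro ⟨-, _, rfl, h⟩; exact hxy h⟩)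
    obtain ⟨y₁, hy₁A, hx₁y₁, hx'y₁⟩ := hy₁ x' hx'A hx'p y' hy'A hx'y'
      fun h => hy'T ⟨hy'A, x₁, rfl, h⟩
    have hZ : ({y₀, y₁} : Set V) ⊆ nbrsIn G A {x₁} := by
      rintro y (rfl | rfl)
      · exact hy₀
      · exact ⟨hy₁A, x₁, rfl, hx₁y₁⟩
    refine exists_isPCM_of_extension hcol (p := p) (A := A) (T := {x₁}) (Z := {y₀, y₁}) (x₁ := x₁)
      (l := x₁) (y₀ := y₀) (g := id) (by rintro x rfl; exact hx₁p) rfl hZ ?_ ?_ hx'p hx'T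
      (Or.inl rfl) hx'y₀ hy'A hx'y' hy'T (fun x hx hne => (hne hx).elim) ?_ (Or.inr rfl) hx₁y₁
      hx'y₁ ?_
    · refine connected_induce_union (connected_induce_singleton x₁) fun y hy => ⟨x₁, rfl, ?_⟩
      obtain ⟨-, _, rfl, h⟩ := hZ hy
      exact h.symm
    · have := Set.ncard_insert_le y₀ {y₁}
      rw [Set.ncard_singleton] at this
      omega
    · rintro x ⟨hx, hne⟩
      exact (hne hx).elim
    · refine hbig.trans (Set.ncard_le_ncard ?_ (Set.toFinite _))
      rintro y ⟨hy, x, hx, hxy⟩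
      exact ⟨hy, x, Or.inr hx, hxy⟩
  -- Grow `T` from `x₁` while it has fewer than `n` neighbours. Only the last added vertex `l` is
  -- unmatched: the next vertex `x'` brings a neighbour `y'` unseen by `T`, which becomes the
  -- partner of `l`. Maximality forces the step that reaches `n` neighbours.
  · obtain ⟨T, ⟨hTA, hx₁T, hTconn, hTn, l, -, g, hg, hginj⟩, hmax⟩ := Set.Finite.exists_maximal
      (s := {T : Set V | (∀ x ∈ T, x ∈ A ∧ col x = p) ∧ x₁ ∈ T ∧
        (G.induce (T ∪ nbrsIn G A T)).Connected ∧ (nbrsIn G A T).ncard < n ∧ ∃ l ∈ T, ∃ g : V → V,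
        (∀ x ∈ T, x ≠ l → g x ∈ nbrsIn G A T ∧ ¬ G.Adj x (g x) ∧ ¬ G.Adj x₁ (g x)) ∧
        Set.InjOn g (T \ {l})}) (Set.toFinite _)
      ⟨{x₁}, by rintro x rfl; exact ⟨hx₁A, hx₁p⟩, rfl,
        connected_induce_union (connected_induce_singleton x₁)
          (by rintro y ⟨-, _, rfl, h⟩; exact ⟨_, rfl, h.symm⟩),
        by omega, x₁, rfl, id, fun x hx hne => (hne hx).elim,
        by rintro x ⟨hx, hne⟩; exact (hne hx).elim⟩
    obtain ⟨x', hx'A, hx'p, hx'T, ⟨y₀, hy₀, hx'y₀⟩, y', hy'A, hx'y', hy'T⟩ :=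
      hnext T hTA ⟨x₁, hx₁T⟩ (by
        by_contra! hall
        have := Set.ncard_le_ncard
          (show {y | y ∈ A ∧ col y = !p} ⊆ nbrsIn G A T from fun y hy => hall y hy.1 hy.2)
          (Set.toFinite _)
        omega)
    have hx₁y' : ¬ G.Adj x₁ y' := fun h => hy'T ⟨hy'A, x₁, hx₁T, h⟩
    obtain ⟨y₁, hy₁A, hx₁y₁, hx'y₁⟩ := hy₁ x' hx'A hx'p y' hy'A hx'y' hx₁y'
    by_cases hfin : n ≤ (nbrsIn G A (insert x' T)).ncard
    · exact exists_isPCM_of_extension hcol (p := p) (fun x hx => (hTA x hx).2) hx₁T subset_rfl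
        hTconn hTn hx'p hx'T hy₀ hx'y₀ hy'A hx'y' hy'T hg hginj ⟨hy₁A, x₁, hx₁T, hx₁y₁⟩ hx₁y₁
        hx'y₁ hfin
    · exfalso
      have hmono : nbrsIn G A T ⊆ nbrsIn G A (insert x' T) := by
        rintro y ⟨hy, x, hx, hxy⟩
        exact ⟨hy, x, Or.inr hx, hxy⟩
      have hTl : ∀ x ∈ T, x ≠ l → Function.update g l y' x = g x := fun x _ hne =>
        Function.update_of_ne hne _ _
      refine hx'T (hmax (y := insert x' T) ⟨?_, Or.inr hx₁T, ?_, by omega, x', Or.inl rfl,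
        Function.update g l y', ?_, ?_⟩ (Set.subset_insert _ _) (Set.mem_insert _ _))
      · rintro x (rfl | hx)
        · exact ⟨hx'A, hx'p⟩
        · exact hTA x hx
      · have h1 := connected_induce_union (B := nbrsIn G A (insert x' T))
          (connected_induce_insert hTconn (Or.inr hy₀) hx'y₀) (by
            rintro y ⟨-, x, rfl | hx, hxy⟩
            · exact ⟨x, Or.inl rfl, hxy.symm⟩
            · exact ⟨x, Or.inr (Or.inl hx), hxy.symm⟩)
        rwa [Set.insert_union, Set.union_assoc, Set.union_eq_right.2 hmono,
          ← Set.insert_union] at h1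
      · rintro x hx hne
        have hxT := hx.resolve_left hne
        by_cases hxl : x = l
        · subst hxl
          rw [Function.update_self]
          exact ⟨⟨hy'A, x', Or.inl rfl, hx'y'⟩, fun h => hy'T ⟨hy'A, x, hxT, h⟩, hx₁y'⟩
        · rw [hTl x hxT hxl]
          obtain ⟨h1, h2⟩ := hg x hxT hxl
          exact ⟨hmono h1, h2⟩
      · rintro x ⟨hx, hxne⟩ y ⟨hy, hyne⟩ hxy
        have hxT := hx.resolve_left hxne
        have hyT := hy.resolve_left hyne
        by_cases hxl : x = l <;> by_cases hyl : y = l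
        · rw [hxl, hyl]
        · rw [hTl y hyT hyl, hxl, Function.update_self] at hxy
          exact (hy'T (hxy ▸ (hg y hyT hyl).1)).elim
        · rw [hTl x hxT hxl, hyl, Function.update_self] at hxy
          exact (hy'T (hxy ▸ (hg x hxT hxl).1)).elim
        · rw [hTl x hxT hxl, hTl y hyT hyl] at hxy
          exact hginj ⟨hxT, hxl⟩ ⟨hyT, hyl⟩ hxy

end PCM

/-! ### Crowns fill their component -/

section Crown

variable {V : Type u} {K : SimpleGraph V} {col : V → Bool} {p : Bool} {m : ℕ}

/-- The vertices `s i` and `x i` induce a bipartite complement of a perfect matching in `K`, with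
the `s i` in the part of colour `p` and without a common neighbour. -/
structure IsCrown (K : SimpleGraph V) (col : V → Bool) (p : Bool) {m : ℕ} (s x : Fin m → V) :
    Prop where
  three_le : 3 ≤ m
  colour_left : ∀ i, col (s i) = p
  colour_right : ∀ i, col (x i) = !p
  adj_iff : ∀ i j, K.Adj (x i) (s j) ↔ i ≠ j
  no_common : ∀ z, ∃ i, ¬ K.Adj z (s i)

variable {s x : Fin m → V}

theorem IsCrown.injective_left (h : IsCrown K col p s x) : Function.Injective s := by
  intro i j hij
  by_contra hne
  have := (h.adj_iff i j).2 hne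
  rw [← hij, h.adj_iff] at this
  exact this rfl

theorem IsCrown.injective_right (h : IsCrown K col p s x) : Function.Injective x := by
  intro i j hij
  by_contra hne
  have := (h.adj_iff i j).2 hne
  rw [hij, h.adj_iff] at this
  exact this rfl

theorem IsCrown.ne (h : IsCrown K col p s x) (i j : Fin m) : s i ≠ x j := by
  intro hij
  have h1 := h.colour_left i
  rw [hij, h.colour_right j] at h1
  simp at h1

theorem exists_ne_ne_of_three_le (hm : 3 ≤ m) (i j : Fin m) : ∃ k : Fin m, k ≠ i ∧ k ≠ j := by
  by_contra! hall
  have h1 : (Finset.univ : Finset (Fin m)) ⊆ {i, j} := fun k _ => by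
    by_cases hk : k = i
    · simp [hk]
    · simp [hall k hk]
  have h2 := (Finset.card_le_card h1).trans Finset.card_le_two
  rw [Finset.card_univ, Fintype.card_fin] at h2
  omega

theorem IsCrown.connected_diff (h : IsCrown K col p s x) (i : Fin m) :
    (K.induce (Set.range x ∪ s '' {j | j ≠ i})).Connected := by
  obtain ⟨j, hji, -⟩ := exists_ne_ne_of_three_le h.three_le i i
  obtain ⟨k, hki, hkj⟩ := exists_ne_ne_of_three_le h.three_le i j
  have h1 := connected_induce_union (B := x '' {l | l ≠ j}) (connected_induce_singleton (s j)) (by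
    rintro _ ⟨l, hl, rfl⟩
    exact ⟨s j, rfl, (h.adj_iff l j).2 hl⟩)
  have h2 := connected_induce_union (B := s '' {l | l ≠ i}) h1 (by
    rintro _ ⟨l, hl, rfl⟩
    obtain ⟨l', hl'l, hl'j⟩ := exists_ne_ne_of_three_le h.three_le l j
    exact ⟨x l', Or.inr ⟨l', hl'j, rfl⟩, ((h.adj_iff l' l).2 hl'l).symm⟩)
  have h3 := connected_induce_insert (v := x j) (a := s k) h2 (Or.inr ⟨k, hki, rfl⟩)
    ((h.adj_iff j k).2 hkj.symm)
  suffices heq : Set.range x ∪ s '' {j | j ≠ i} =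
      insert (x j) ({s j} ∪ x '' {l | l ≠ j} ∪ s '' {l | l ≠ i}) by rwa [heq]
  ext z
  simp only [Set.mem_union, Set.mem_range, Set.mem_image, Set.mem_ofPred_eq, Set.mem_insert_iff,
    Set.mem_singleton_iff]
  constructor
  · rintro (⟨l, rfl⟩ | hz)
    · by_cases hl : l = j
      · exact Or.inl (by rw [hl])
      · exact Or.inr (Or.inl (Or.inr ⟨l, hl, rfl⟩))
    · exact Or.inr (Or.inr hz)
  · rintro (rfl | (rfl | ⟨l, -, rfl⟩) | hz)
    · exact Or.inl ⟨j, rfl⟩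
    · exact Or.inr ⟨j, hji, rfl⟩
    · exact Or.inl ⟨l, rfl⟩
    · exact Or.inr hz

theorem IsCrown.not_adj_left (hcol : IsTwoColouring K col) (h : IsCrown K col p s x)
    (i j : Fin m) : ¬ K.Adj (s i) (s j) :=
  hcol.not_adj (by rw [h.colour_left, h.colour_left])

theorem IsCrown.not_adj_right (hcol : IsTwoColouring K col) (h : IsCrown K col p s x)
    (i j : Fin m) : ¬ K.Adj (x i) (x j) :=
  hcol.not_adj (by rw [h.colour_right, h.colour_right])

/-- Exchange `s i` and `x i` on the crown minus one `s i₀`. An extension would carry a common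
neighbour of all `x i` to one of all `s i`. -/
theorem IsCrown.swap (hK : Extends K K) (hcol : IsTwoColouring K col) (h : IsCrown K col p s x) :
    IsCrown K col (!p) x s := by
  classical
  have hm := h.three_le
  refine ⟨hm, h.colour_right, by simpa using h.colour_left, fun i j => ?_, ?_⟩
  · rw [K.adj_comm, h.adj_iff, ne_comm]
  by_contra! hz
  obtain ⟨z, hz⟩ := hz
  let φ : V → V := fun v => if hv : ∃ i, s i = v then x hv.choose else
    if hv : ∃ i, x i = v then s hv.choose else v
  have hφs : ∀ i, φ (s i) = x i := fun i => by
    have hv : ∃ j, s j = s i := ⟨i, rfl⟩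
    simp only [φ, dif_pos hv]
    rw [h.injective_left hv.choose_spec]
  have hφx : ∀ i, φ (x i) = s i := fun i => by
    have hv' : ¬ ∃ j, s j = x i := fun ⟨j, hj⟩ => h.ne j i hj
    have hv : ∃ j, x j = x i := ⟨i, rfl⟩
    simp only [φ, dif_neg hv', dif_pos hv]
    rw [h.injective_right hv.choose_spec]
  have i₀ : Fin m := ⟨0, by omega⟩
  obtain ⟨z', hz'⟩ := hK.exists_adj (h.connected_diff i₀) (φ := φ) (by
    rintro _ (⟨i, rfl⟩ | ⟨i, -, rfl⟩) _ (⟨j, rfl⟩ | ⟨j, -, rfl⟩) hij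
    · exact (h.not_adj_right hcol _ _ hij).elim
    · rw [hφx, hφs, K.adj_comm, h.adj_iff]
      exact ((h.adj_iff _ _).1 hij).symm
    · rw [hφx, hφs, h.adj_iff]
      exact ((h.adj_iff _ _).1 hij.symm).symm
    · exact (h.not_adj_left hcol _ _ hij).elim) z
  obtain ⟨i, hi⟩ := h.no_common z'
  have := hz' (x i) (Or.inl ⟨i, rfl⟩) (hz i)
  rw [hφx] at this
  exact hi this

/-- Otherwise fix the crown without `s i` and send `v` to `x i`. The image of `s i` would be a
common neighbour of all `x l`, excluded by `IsCrown.swap`. -/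
theorem IsCrown.eq_of_adj_of_adj (hK : Extends K K) (hcol : IsTwoColouring K col)
    (h : IsCrown K col p s x) {v : V} (hv : ∀ l, v ≠ x l) {i j : Fin m} (hi : K.Adj v (s i))
    (hj : K.Adj v (s j)) : i = j := by
  classical
  by_contra hij
  have hvc : col v = !p := by
    rw [hcol.ne_of_adj hi.symm, h.colour_left]
  have hvA : v ∉ Set.range x ∪ s '' {j | j ≠ i} := by
    rintro (⟨l, rfl⟩ | ⟨l, -, rfl⟩)
    · exact hv l rfl
    · exact h.not_adj_left hcol _ _ hi
  obtain ⟨z, hz⟩ := hK.exists_adj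
    (connected_induce_insert (h.connected_diff i) (Or.inr ⟨j, fun h => hij h.symm, rfl⟩) hj)
    (HomOn.insert (φ := id) (w := x i) (fun _ _ _ _ h => h) hvA (by
      rintro _ (⟨l, rfl⟩ | ⟨l, hl, rfl⟩) hvl
      · exact (hcol.not_adj (by rw [hvc, h.colour_right]) hvl).elim
      · exact (h.adj_iff _ _).2 fun h => hl h.symm)) (s i)
  obtain ⟨l, hl⟩ := (h.swap hK hcol).no_common z
  by_cases hli : l = i
  · have := hz v (Or.inl rfl) hi.symm
    rw [Function.update_self, ← hli] at this
    exact hl this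
  · have := hz (x l) (Or.inr (Or.inl ⟨l, rfl⟩)) ((h.adj_iff l i).2 hli).symm
    rw [Function.update_of_ne (hv l).symm] at this
    exact hl this

/-- An outside `y` sees only `x i`, and a common neighbour `v` of `y` and `s i` sees only `s i`
among the `s j`. Fix the crown without `x i`, send `v` to some `x t` with `t ≠ i` and `y` to `s i`;
the image of `x i` would then see every `s j`. -/
theorem IsCrown.eq_of_adj (hK : Extends K K) (hcol : IsTwoColouring K col)
    (hpair : ∀ a b, col a = col b → ∃ z, K.Adj z a ∧ K.Adj z b) (h : IsCrown K col p s x) {y : V}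
    {i : Fin m} (hi : K.Adj y (x i)) : ∃ j, y = s j := by
  classical
  by_contra! hy
  have hswap := h.swap hK hcol
  have hyc : col y = p := by
    rw [hcol.ne_of_adj hi.symm, h.colour_right, Bool.not_not]
  obtain ⟨v, hvy, hvs⟩ := hpair y (s i) (by rw [hyc, h.colour_left])
  have hyx : ∀ l, K.Adj y (x l) → l = i := fun l hl => hswap.eq_of_adj_of_adj hK hcol hy hl hi
  have hvx : ∀ l, v ≠ x l := by
    rintro l rfl
    rw [hyx l hvy.symm, h.adj_iff] at hvs
    exact hvs rfl
  have hvs' : ∀ j, K.Adj v (s j) → j = i := fun j hj => h.eq_of_adj_of_adj hK hcol hvx hj hvs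
  have hvc : col v = !p := by
    rw [hcol.ne_of_adj hvs.symm, h.colour_left]
  obtain ⟨t, ht, -⟩ := exists_ne_ne_of_three_le h.three_le i i
  have hconn := hswap.connected_diff i
  have hvA : v ∉ Set.range s ∪ x '' {j | j ≠ i} := by
    rintro (⟨l, rfl⟩ | ⟨l, -, rfl⟩)
    · exact h.not_adj_left hcol _ _ hvs
    · exact hvx l rfl
  have hyA : y ∉ insert v (Set.range s ∪ x '' {j | j ≠ i}) := by
    rintro (rfl | ⟨l, rfl⟩ | ⟨l, -, rfl⟩)
    · exact K.loopless.irrefl _ hvy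
    · exact hy l rfl
    · exact h.not_adj_right hcol _ _ hi
  have hhom : HomOn K K (Set.range s ∪ x '' {j | j ≠ i}) id := fun _ _ _ _ h => h
  have hhom2 := hhom.insert (w := x t) hvA (by
    rintro _ (⟨l, rfl⟩ | ⟨l, -, rfl⟩) hvl
    · rw [hvs' l hvl]
      exact (h.adj_iff _ _).2 ht
    · exact (hcol.not_adj (by rw [hvc, h.colour_right]) hvl).elim)
  have hhom3 := hhom2.insert (w := s i) hyA (by
    rintro _ (rfl | ⟨l, rfl⟩ | ⟨l, hl, rfl⟩) hyl
    · rw [Function.update_self]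
      exact ((h.adj_iff _ _).2 ht).symm
    · exact (hcol.not_adj (by rw [hyc, h.colour_left]) hyl).elim
    · exact (hl (hyx l hyl)).elim)
  obtain ⟨z, hz⟩ := hK.exists_adj
    (connected_induce_insert (connected_induce_insert hconn (Or.inl ⟨i, rfl⟩) hvs)
      (Or.inl rfl) hvy.symm) hhom3 (x i)
  obtain ⟨j, hj⟩ := h.no_common z
  by_cases hji : j = i
  · have := hz y (Or.inl rfl) hi.symm
    rw [Function.update_self, ← hji] at this
    exact hj this
  · have := hz (s j) (Or.inr (Or.inr (Or.inl ⟨j, rfl⟩))) ((h.adj_iff i j).2 (Ne.symm hji))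
    rw [Function.update_of_ne (hy j).symm, Function.update_of_ne] at this
    · exact hj this
    · intro hsv
      exact hvA (Or.inl ⟨j, hsv⟩)

theorem IsCrown.eq_left (hK : Extends K K) (hcol : IsTwoColouring K col)
    (hpair : ∀ a b, col a = col b → ∃ z, K.Adj z a ∧ K.Adj z b) (h : IsCrown K col p s x) {y : V}
    (hy : col y = p) : ∃ j, y = s j := by
  have i₀ : Fin m := ⟨0, by have := h.three_le; omega⟩
  obtain ⟨v, hvy, hvs⟩ := hpair y (s i₀) (by rw [hy, h.colour_left])
  obtain ⟨l, rfl⟩ := (h.swap hK hcol).eq_of_adj hK hcol hpair hvs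
  exact h.eq_of_adj hK hcol hpair hvy.symm

theorem IsCrown.nonempty_iso (hK : Extends K K) (hcol : IsTwoColouring K col)
    (hpair : ∀ a b, col a = col b → ∃ z, K.Adj z a ∧ K.Adj z b) (h : IsCrown K col p s x) :
    Nonempty (K ≃g matchingComplement m) := by
  have hbij : Function.Bijective (Sum.elim s x) := by
    refine ⟨h.injective_left.sumElim h.injective_right h.ne, fun v => ?_⟩
    by_cases hv : col v = p
    · obtain ⟨j, rfl⟩ := h.eq_left hK hcol hpair hv
      exact ⟨Sum.inl j, rfl⟩
    · have hv' : col v = !p := by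
        cases p <;> cases hc : col v <;> simp_all
      obtain ⟨j, rfl⟩ := (h.swap hK hcol).eq_left hK hcol hpair hv'
      exact ⟨Sum.inr j, rfl⟩
  refine ⟨SimpleGraph.Iso.symm ⟨Equiv.ofBijective _ hbij, fun {a b} => ?_⟩⟩
  simp only [Equiv.ofBijective_apply]
  rcases a with a | a <;> rcases b with b | b <;> simp only [Sum.elim_inl, Sum.elim_inr]
  · exact iff_of_false (h.not_adj_left hcol _ _) fun h => h
  · rw [K.adj_comm, h.adj_iff]
    exact ne_comm
  · rw [h.adj_iff]
    exact Iff.rfl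
  · exact iff_of_false (h.not_adj_right hcol _ _) fun h => h

/-- A bipartite C-HH graph in which any two vertices of the same part have a common neighbour is a
bipartite complement of a perfect matching, unless each part has a common neighbour. -/
theorem nonempty_iso_matchingComplement_of_no_common [Finite V] [Nonempty V]
    (hK : Extends K K)
    (hcol : IsTwoColouring K col) (hpair : ∀ a b, col a = col b → ∃ z, K.Adj z a ∧ K.Adj z b)
    (hno : ¬ ∃ v, ∀ y, col y = p → K.Adj v y) :
    ∃ m, 3 ≤ m ∧ Nonempty (K ≃g matchingComplement m) := by
  classical
  have : Fintype V := Fintype.ofFinite V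
  -- By minimality each `S.erase (s i)` has a common neighbour `x i`, which misses `s i`; so `S` and
  -- the `x i` form a crown. Common neighbours of pairs force at least three vertices.
  obtain ⟨S, ⟨hSp, hS⟩, hmin⟩ := WellFounded.has_min
    (InvImage.wf (fun S : Finset V => S.card) Nat.lt_wfRel.wf)
    {S : Finset V | (∀ y ∈ S, col y = p) ∧ ¬ ∃ v, ∀ y ∈ S, K.Adj v y}
    ⟨Finset.univ.filter fun y => col y = p, by simp, by simpa using hno⟩
  have h3 : 3 ≤ S.card := by
    by_contra! hlt
    apply hS
    by_cases hall : ∃ a, ∀ y ∈ S, y = a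
    · obtain ⟨a, ha⟩ := hall
      obtain ⟨v, hv, -⟩ := hpair a a rfl
      exact ⟨v, fun y hy => by rw [ha y hy]; exact hv⟩
    push Not at hall
    obtain ⟨o⟩ := ‹Nonempty V›
    obtain ⟨a, ha, -⟩ := hall o
    obtain ⟨b, hb, hba⟩ := hall a
    obtain ⟨v, hva, hvb⟩ := hpair a b ((hSp a ha).trans (hSp b hb).symm)
    refine ⟨v, fun y hy => ?_⟩
    have hsub : ({a, b} : Finset V) ⊆ S := by
      simp [Finset.insert_subset_iff, ha, hb]
    have := Finset.eq_of_subset_of_card_le hsub (by rw [Finset.card_pair hba.symm]; omega)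
    rw [← this] at hy
    simp only [Finset.mem_insert, Finset.mem_singleton] at hy
    rcases hy with rfl | rfl <;> assumption
  let s : Fin S.card → V := fun i => (S.equivFin.symm i : V)
  have hsS : ∀ i, s i ∈ S := fun i => (S.equivFin.symm i).2
  have hsurj : ∀ y ∈ S, ∃ i, s i = y := fun y hy => ⟨S.equivFin ⟨y, hy⟩, by simp [s]⟩
  have hsinj : Function.Injective s := Subtype.val_injective.comp S.equivFin.symm.injective
  have hx : ∀ i, ∃ v, ∀ y ∈ S.erase (s i), K.Adj v y := by
    intro i
    by_contra hcon
    exact hmin (S.erase (s i)) ⟨fun y hy => hSp y (Finset.mem_of_mem_erase hy), hcon⟩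
      (Finset.card_erase_lt_of_mem (hsS i))
  choose x hx using hx
  have hxs : ∀ i j, K.Adj (x i) (s j) ↔ i ≠ j := by
    intro i j
    constructor
    · rintro h rfl
      refine hS ⟨x i, fun y hy => ?_⟩
      by_cases hyi : y = s i
      · rw [hyi]; exact h
      · exact hx i y (Finset.mem_erase.2 ⟨hyi, hy⟩)
    · intro hij
      exact hx i _ (Finset.mem_erase.2 ⟨fun h => hij (hsinj h).symm, hsS j⟩)
  refine ⟨S.card, h3, IsCrown.nonempty_iso hK hcol hpair (p := p) (s := s) (x := x)
    ⟨h3, fun i => hSp _ (hsS i), fun i => ?_, hxs, fun z => ?_⟩⟩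
  · obtain ⟨j, hj, -⟩ := exists_ne_ne_of_three_le h3 i i
    rw [hcol.ne_of_adj ((hxs i j).2 hj.symm).symm, hSp _ (hsS j)]
  · by_contra! hz
    exact hS ⟨z, fun y hy => by
      obtain ⟨i, rfl⟩ := hsurj y hy
      exact hz i⟩

end Crown

/-! ### Homomorphisms into crowns -/

section MatchingComplement

variable {V : Type u} {W : Type v} {H : SimpleGraph V} {K : SimpleGraph W} {m n : ℕ}

/-- The vertices of `matchingComplement n`, by part and index. -/
def partVertex (n : ℕ) (b : Bool) (i : Fin n) : Fin n ⊕ Fin n :=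
  if b then .inl i else .inr i

theorem isLeft_partVertex (b : Bool) (i : Fin n) : (partVertex n b i).isLeft = b := by
  cases b <;> rfl

theorem partVertex_injective (b : Bool) : Function.Injective (partVertex n b) := by
  cases b
  · exact Sum.inr_injective
  · exact Sum.inl_injective

theorem exists_eq_partVertex (z : Fin n ⊕ Fin n) : ∃ i, z = partVertex n z.isLeft i := by
  rcases z with i | i
  · exact ⟨i, rfl⟩
  · exact ⟨i, rfl⟩

theorem matchingComplement_adj_partVertex (b : Bool) (i j : Fin n) :
    (matchingComplement n).Adj (partVertex n (!b) i) (partVertex n b j) ↔ i ≠ j := by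
  cases b <;> exact Iff.rfl

theorem isTwoColouring_matchingComplement (n : ℕ) :
    IsTwoColouring (matchingComplement n) Sum.isLeft := by
  rintro (a | a) (b | b) h
  · exact h.elim
  · simp
  · simp
  · exact h.elim

theorem IsTwoColouring.comp_hom {col : W → Bool} (hcol : IsTwoColouring K col) (ψ : H →g K) :
    IsTwoColouring H (col ∘ ψ) := fun _ _ hab => hcol _ _ (ψ.map_adj hab)

theorem connected_induce_univ (hH : H.Connected) : (H.induce Set.univ).Connected :=
  (SimpleGraph.induceUnivIso H).connected_iff.2 hH

/-- Extension of homomorphisms into a bipartite complement of a perfect matching. -/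
theorem extends_matchingComplement [Finite V] (hH : H.Connected) {col : V → Bool}
    (hcol : IsTwoColouring H col) (hfree : IsPCMFree n H) (hn : 3 ≤ n) :
    Extends H (matchingComplement n) := by
  have hcol' := isTwoColouring_matchingComplement n
  have : Nonempty (Fin n ⊕ Fin n) := ⟨.inl ⟨0, by omega⟩⟩
  refine extends_of_exists_adj hH fun A hA v hv hvA φ hφ => ?_
  obtain ⟨a, ha, hva⟩ := hvA
  by_contra! hno
  have hcolv : ∀ b, H.Adj v b → col b = col a := fun b hvb => by
    rw [hcol.ne_of_adj hva, hcol.ne_of_adj hvb]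
  -- Sending `v` to the vertex of index `k` in the opposite part fails only if some neighbour of `v`
  -- goes to its non-neighbour of index `k`. So the images fill a part, and no vertex of `A` sees
  -- all these preimages.
  have hk : ∀ k, ∃ y ∈ A, col y = col a ∧ φ y = partVertex n (φ a).isLeft k := by
    intro k
    obtain ⟨y, hy, hvy, hky⟩ := hno (partVertex n (!(φ a).isLeft) k)
    refine ⟨y, hy, hcolv y hvy, ?_⟩
    obtain ⟨i, hi⟩ := exists_eq_partVertex (φ y)
    rw [hφ.colour_eq hA hcol hcol' hy ha (hcolv y hvy)] at hi
    rw [hi, matchingComplement_adj_partVertex, not_not] at hky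
    rw [hi, hky]
  choose y hyA hyc hyφ using hk
  have hyinj : Function.Injective y := fun i j hij =>
    partVertex_injective (φ a).isLeft (by rw [← hyφ i, ← hyφ j, hij])
  obtain ⟨S, hS⟩ := exists_isPCM hcol (p := !col a) hA hn (by
    rw [Bool.not_not]
    calc n = (Set.range y).ncard := by
          rw [Set.ncard_range_of_injective hyinj, Nat.card_fin]
      _ ≤ _ := Set.ncard_le_ncard (by
          rintro _ ⟨i, rfl⟩
          exact ⟨hyA i, hyc i⟩) (Set.toFinite _)) (by
    intro x hx hxc
    rw [Bool.not_not]
    obtain ⟨i, hi⟩ := exists_eq_partVertex (φ x)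
    refine ⟨y i, hyA i, hyc i, fun hadj => ?_⟩
    have h1 := hφ x hx _ (hyA i) hadj
    have h2 := hcol'.ne_of_adj h1
    rw [hyφ, isLeft_partVertex] at h2
    rw [hi, hyφ, h2, SimpleGraph.adj_comm, matchingComplement_adj_partVertex] at h1
    exact h1 rfl)
  exact hfree S hS

/-- A `PCM(n)` graph maps onto one part of `matchingComplement n`, which has no common neighbour. -/
theorem not_isPCM_of_extends [Finite V] (h : Extends H (matchingComplement n)) {col : V → Bool}
    (hcol : IsTwoColouring H col)
    (hcn : ∀ p, ∀ Y : Set V, (∀ y ∈ Y, col y = p) → Y.ncard = n → ∃ w, ∀ y ∈ Y, H.Adj w y) :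
    IsPCMFree n H := by
  classical
  rintro S ⟨hconn, X, Y, hbip, h2, hle, hYn, f, hmaps, -, hf⟩
  obtain ⟨col', hcol', hX, hY⟩ := hbip.exists_colouring
  obtain ⟨o, ho⟩ : Y.Nonempty := (Set.ncard_pos (Set.toFinite _)).1 (by omega)
  have hpar : ∀ z : S, xor (col z) (col' z) = xor (col o) (col' o) := by
    intro z
    by_contra hz
    obtain ⟨a, b, ha, hb, hab⟩ := exists_boundary_adj' hconn
      (U := {z : S | xor (col z) (col' z) = xor (col o) (col' o)}) (x := o) rfl hz
    refine hb (Eq.trans ?_ ha)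
    simp [hcol.ne_of_adj (show H.Adj a b from hab), hcol'.ne_of_adj hab]
  let e : Y ≃ Fin n := Finite.equivFinOfCardEq (by rw [Nat.card_coe_set_eq, hYn])
  -- `Y` is mapped bijectively onto one part and `x` to the unique opposite vertex not adjacent to
  -- the image of `f x`. The last default is never reached, as `X` and `Y` cover `S`.
  let φ : S → Fin n ⊕ Fin n := fun z =>
    if hz : z ∈ X then .inl (e ⟨f z, hmaps hz⟩) else
      if hz : z ∈ Y then .inr (e ⟨z, hz⟩) else .inr (e ⟨o, ho⟩)
  have hφX : ∀ z (hz : z ∈ X), φ z = .inl (e ⟨f z, hmaps hz⟩) := fun z hz => dif_pos hz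
  have hφY : ∀ z (hz : z ∈ Y), φ z = .inr (e ⟨z, hz⟩) := fun z hz => by
    have hzX : z ∉ X := by
      rw [hX, (hY z).1 hz]
      simp
    simp only [φ, dif_neg hzX, dif_pos hz]
  have hXY : ∀ x ∈ X, ∀ y ∈ Y, (H.induce S).Adj x y → (matchingComplement n).Adj (φ x) (φ y) := by
    intro x hx y hy hxy
    rw [hφX x hx, hφY y hy]
    intro heq
    have := congrArg Subtype.val (e.injective heq)
    simp only at this
    exact hf x hx (this ▸ hxy)
  obtain ⟨ψ, hψ⟩ := h S hconn ⟨φ, fun {a b} hab => by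
    rcases hbip.1.mem_of_adj hab with ⟨ha, hb⟩ | ⟨ha, hb⟩
    · exact hXY a ha b hb hab
    · exact (hXY b hb a ha hab.symm).symm⟩
  obtain ⟨w, hw⟩ := hcn (col o) (Subtype.val '' Y) (by
    rintro _ ⟨z, hz, rfl⟩
    have := hpar z
    rw [(hY z).1 hz, (hY o).1 ho] at this
    simpa using this) (by rw [Set.ncard_image_of_injective _ Subtype.val_injective, hYn])
  have hall : ∀ k, (matchingComplement n).Adj (ψ w) (.inr k) := by
    intro k
    have h1 := ψ.map_adj (hw _ ⟨(e.symm k).1, (e.symm k).2, rfl⟩)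
    rw [hψ] at h1
    change (matchingComplement n).Adj (ψ w) (φ _) at h1
    rw [hφY _ (e.symm k).2] at h1
    simpa using h1
  rcases hψw : ψ w with k | k
  · have := hall k
    rw [hψw] at this
    exact this rfl
  · have := hall k
    rw [hψw] at this
    exact this

/-- If `m > n`, then `H` contains a PCM(n) graph, since neither part has a common neighbour. Yet any
`n` vertices of a part omit one, whose partner is adjacent to all of them, contradicting
`not_isPCM_of_extends`. -/
theorem le_of_extends_matchingComplement [Finite V] (e : H ≃g matchingComplement m)
    (hH : H.Connected) (h : Extends H (matchingComplement n)) (hn : 3 ≤ n) : m ≤ n := by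
  by_contra! hlt
  have hcol : IsTwoColouring H (Sum.isLeft ∘ e) :=
    (isTwoColouring_matchingComplement m).comp_hom e.toHom
  have hinj : ∀ b, Function.Injective (fun i => e.symm (partVertex m b i)) := fun b =>
    e.symm.injective.comp (partVertex_injective b)
  have hc : ∀ b i, (Sum.isLeft ∘ e) (e.symm (partVertex m b i)) = b := fun b i => by
    simp [isLeft_partVertex]
  have hex : ∀ x, ∃ i, x = e.symm (partVertex m ((Sum.isLeft ∘ e) x) i) := fun x => by
    obtain ⟨i, hi⟩ := exists_eq_partVertex (e x)
    exact ⟨i, by rw [Function.comp_apply, ← hi, e.symm_apply_apply]⟩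
  obtain ⟨S, hS⟩ := exists_isPCM hcol (p := true) (connected_induce_univ hH) hn (by
    calc n ≤ (Set.range fun i => e.symm (partVertex m (!true) i)).ncard := by
          rw [Set.ncard_range_of_injective (hinj _), Nat.card_fin]
          omega
      _ ≤ _ := Set.ncard_le_ncard (by
          rintro _ ⟨i, rfl⟩
          exact ⟨trivial, hc _ i⟩) (Set.toFinite _)) (by
    intro x _ hx
    obtain ⟨i, hi⟩ := hex x
    rw [hx] at hi
    refine ⟨e.symm (partVertex m (!true) i), trivial, hc _ i, ?_⟩
    rw [hi, e.symm.map_adj_iff, SimpleGraph.adj_comm, matchingComplement_adj_partVertex]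
    simp)
  refine not_isPCM_of_extends h hcol ?_ S hS
  intro p Y hY hYn
  obtain ⟨k, hk⟩ : ∃ k, e.symm (partVertex m p k) ∉ Y := by
    by_contra! hall
    have h1 : (Set.range fun i => e.symm (partVertex m p i)) ⊆ Y := by
      rintro _ ⟨i, rfl⟩
      exact hall i
    have h2 := Set.ncard_le_ncard h1 (Set.toFinite _)
    rw [Set.ncard_range_of_injective (hinj _), Nat.card_fin] at h2
    omega
  refine ⟨e.symm (partVertex m (!p) k), fun y hy => ?_⟩
  obtain ⟨i, hi⟩ := hex y
  rw [hY y hy] at hi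
  rw [hi, e.symm.map_adj_iff, matchingComplement_adj_partVertex]
  rintro rfl
  exact hk (hi ▸ hy)

end MatchingComplement

/-! ### The dichotomy for bipartite components -/

section Bipartite

variable {V : Type u} {W : Type v} {H : SimpleGraph V} {K : SimpleGraph W}

/-- Vertices of equal colour are joined by an even walk; replacing its first four steps by two
shortens it until two steps remain. -/
theorem exists_common_adj_of_colour_eq [Nontrivial V] (hH : H.Connected) {col : V → Bool}
    (hcol : IsTwoColouring H col)
    (hfour : ∀ a b (p : H.Walk a b), p.length = 4 → ∃ z, H.Adj z a ∧ H.Adj z b) (a b : V)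
    (hab : col a = col b) : ∃ z, H.Adj z a ∧ H.Adj z b := by
  have key : ∀ k a b (p : H.Walk a b), p.length = 2 * (k + 1) → ∃ z, H.Adj z a ∧ H.Adj z b := by
    intro k
    induction k with
    | zero =>
      intro a b p hp
      have h1 := p.adj_getVert_succ (i := 0) (by omega)
      have h2 := p.adj_getVert_succ (i := 1) (by omega)
      rw [p.getVert_zero] at h1
      rw [show 1 + 1 = p.length by omega, p.getVert_length] at h2
      exact ⟨_, h1.symm, h2⟩
    | succ k ih =>
      intro a b p hp
      obtain ⟨z, hz1, hz2⟩ := hfour _ _ (p.take 4) (by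
        rw [SimpleGraph.Walk.take_length]
        omega)
      exact ih a b (.cons hz1.symm (.cons hz2 (p.drop 4))) (by
        simp only [SimpleGraph.Walk.length_cons, SimpleGraph.Walk.drop_length]
        omega)
  obtain ⟨p⟩ := hH.preconnected a b
  have heven : Even p.length :=
    (SimpleGraph.Coloring.even_length_iff_congr
      (SimpleGraph.Coloring.mk col fun {a b} h => hcol a b h) p).2 (by
        change col a = true ↔ col b = true
        rw [hab])
  obtain ⟨k, hk⟩ := heven
  rcases k with _ | k
  · obtain rfl : a = b := p.eq_of_length_eq_zero (by omega)
    obtain ⟨z, hz⟩ := hH.preconnected.exists_adj_of_nontrivial a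
    exact ⟨z, hz.symm, hz.symm⟩
  · exact key k a b p (by omega)

theorem even_of_embedding_cycleGraph {col : V → Bool} (hcol : IsTwoColouring H col) {k : ℕ}
    (hk : 3 ≤ k) (f : SimpleGraph.cycleGraph k ↪g H) : Even k := by
  by_contra hodd
  rw [Nat.not_even_iff_odd] at hodd
  have h1 := SimpleGraph.chromaticNumber_cycleGraph_of_odd k (by omega) hodd
  have h2 : (SimpleGraph.cycleGraph k).Colorable 2 :=
    SimpleGraph.Coloring.colorable (α := Bool)
      (SimpleGraph.Coloring.mk (col ∘ f) fun {a b} h => hcol _ _ (f.toHom.map_adj h))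
  have h3 := h2.chromaticNumber_le
  rw [h1] at h3
  exact absurd h3 (by decide)

/-- If `H` has an induced cycle other than a square, or an induced two-squares graph, then ends of
walks of length four have common neighbours. -/
theorem Extends.exists_common_adj_of_not_squares {col : V → Bool} (h : Extends H K)
    (hcol : IsTwoColouring H col)
    (hH : AllInducedCyclesSquares H → twoSquares.IsIndContained H) {a b : W} (p : K.Walk a b)
    (hp : p.length = 4) : ∃ z, K.Adj z a ∧ K.Adj z b := by
  by_cases hsq : AllInducedCyclesSquares H
  · obtain ⟨f⟩ := hH hsq
    obtain ⟨q, v, hq, hv0, hvl⟩ := exists_inducedPath_of_twoSquares f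
    exact h.exists_common_adj_of_walk hq hv0 hvl p hp
  · simp only [AllInducedCyclesSquares] at hsq
    push Not at hsq
    obtain ⟨k, hk, ⟨f⟩, hk4⟩ := hsq
    obtain ⟨m, hm⟩ := even_of_embedding_cycleGraph hcol hk f
    obtain ⟨q, v, hq, -, hv0, hvl⟩ := exists_inducedPath_of_cycle (by omega) f
    have hadj := p.adj_getVert_succ (i := 0) (by omega)
    rw [p.getVert_zero] at hadj
    -- The cycle has even length `2 * m ≥ 6`, so the path has length `2 * m - 2 = 4 + 2 * (m - 3)`.
    obtain ⟨p', hp'⟩ := exists_walk_length_add_two hadj ⟨p, hp⟩ (m - 3)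
    exact h.exists_common_adj_of_walk hq hv0 hvl p' (by omega)

/-- The dichotomy for connected bipartite C-HH graphs other than those without two-squares graphs
all of whose induced cycles are squares. -/
theorem partsHaveCommonNeighbour_or_iso [Finite V] [Nontrivial V] (h : Extends H H)
    (hH : H.Connected) {col : V → Bool} (hcol : IsTwoColouring H col)
    (hfour : ∀ a b (p : H.Walk a b), p.length = 4 → ∃ z, H.Adj z a ∧ H.Adj z b) :
    PartsHaveCommonNeighbour H ∨ ∃ m, 3 ≤ m ∧ Nonempty (H ≃g matchingComplement m) := by
  rw [partsHaveCommonNeighbour_iff, or_iff_not_imp_left]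
  intro hno
  push Not at hno
  obtain ⟨p, hp⟩ := hno col hcol
  have : Nonempty V := hH.nonempty
  refine nonempty_iso_matchingComplement_of_no_common (p := p) h hcol
    (exists_common_adj_of_colour_eq hH hcol hfour) ?_
  push Not
  exact hp

end Bipartite

/-! ### Properties passing from one component to all -/

section Components

variable {V : Type u} {G : SimpleGraph V}

theorem eq_bot_of_subsingleton
    (hE : ∀ c d : G.ConnectedComponent, Extends c.toSimpleGraph d.toSimpleGraph)
    {c : G.ConnectedComponent} (hc : ¬ Nontrivial c) : G = ⊥ := by
  rw [not_nontrivial_iff_subsingleton] at hc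
  ext a b
  simp only [SimpleGraph.bot_adj, iff_false]
  intro hab
  let d := G.connectedComponentMk a
  have hbd : b ∈ d := (d.mem_supp_congr_adj hab).1 rfl
  obtain ⟨o⟩ := c.connected_toSimpleGraph.nonempty
  obtain ⟨ψ, -⟩ := (hE d c).exists_hom_apply_eq ⟨a, rfl⟩ o
  have h1 : d.toSimpleGraph.Adj ⟨a, rfl⟩ ⟨b, hbd⟩ := hab
  exact (ψ.map_adj h1).ne (Subsingleton.elim _ _)

/-- Homomorphisms are injective on cliques and exist both ways between any two components, so all
components share one clique number, which is the common `n`. -/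
theorem exists_forall_isTreelike [Finite V]
    (hE : ∀ c d : G.ConnectedComponent, Extends c.toSimpleGraph d.toSimpleGraph)
    (hnt : ∀ c : G.ConnectedComponent, Nontrivial c) {c : G.ConnectedComponent}
    (hc : ∀ col, ¬ IsTwoColouring c.toSimpleGraph col) :
    ∃ n, 3 ≤ n ∧ ∀ d : G.ConnectedComponent, IsTreelike n d.toSimpleGraph := by
  classical
  obtain ⟨C, hC⟩ := c.toSimpleGraph.exists_isNClique_cliqueNum
  have : Nontrivial c := hnt c
  have : Fintype c := Fintype.ofFinite c
  have hhom : ∀ d d' : G.ConnectedComponent, Nonempty (d.toSimpleGraph →g d'.toSimpleGraph) := by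
    intro d d'
    obtain ⟨a⟩ := d.connected_toSimpleGraph.nonempty
    obtain ⟨b⟩ := d'.connected_toSimpleGraph.nonempty
    exact ⟨((hE d d').exists_hom_apply_eq a b).choose⟩
  have hthree : 3 ≤ c.toSimpleGraph.cliqueNum := by
    obtain ⟨x, y, z, hxy, hzx, hzy⟩ :=
      (hE c c).exists_triangle c.connected_toSimpleGraph c.connected_toSimpleGraph hc
    have hcl : c.toSimpleGraph.IsNClique 3 {x, y, z} :=
      SimpleGraph.is3Clique_triple_iff.2 ⟨hxy, hzx.symm, hzy.symm⟩
    have := hcl.isClique.card_le_cliqueNum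
    rwa [hcl.card_eq] at this
  refine ⟨c.toSimpleGraph.cliqueNum, hthree, fun d => ?_⟩
  have : Nontrivial d := hnt d
  obtain ⟨ψ⟩ := hhom c d
  obtain ⟨ψ'⟩ := hhom d c
  refine (hE d d).isTreelike d.connected_toSimpleGraph (isNClique_image_hom hC ψ)
    (fun D hD => ?_) hthree
  have h1 := isNClique_image_hom hD ψ'
  have h2 := h1.isClique.card_le_cliqueNum
  rw [h1.card_eq] at h2
  omega

end Components

end CHHGraph

/-! ### The classification -/

theorem mainTheorem2 {V : Type*} [Finite V] (G : SimpleGraph V) :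
    CHHGraph.IsCHH G ↔
      (∀ c : G.ConnectedComponent, CHHGraph.IsCHH c.toSimpleGraph) ∧
      ( -- (a) an independent set
        G = ⊥ ∨
        -- (b) all components `K_n`-treelike for one `n ≥ 3`
        (∃ n, 3 ≤ n ∧ ∀ c : G.ConnectedComponent, CHHGraph.IsTreelike n c.toSimpleGraph) ∨
        -- (c) all components nontrivial, with only square induced cycles and no two-squares graph
        (∀ c : G.ConnectedComponent, Nontrivial c ∧
          CHHGraph.AllInducedCyclesSquares c.toSimpleGraph ∧
          ¬ CHHGraph.twoSquares.IsIndContained c.toSimpleGraph) ∨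
        -- (d) all components bipartite with each part having a common neighbour
        (∀ c : G.ConnectedComponent, CHHGraph.PartsHaveCommonNeighbour c.toSimpleGraph) ∨
        -- (e) for one `n ≥ 3`, at least one component is a bipartite complement of a perfect
        -- matching on `n + n` vertices, and all components that are not copies of it are
        -- `PCM(n)`-free bipartite graphs whose parts each have a common neighbour
        (∃ n, 3 ≤ n ∧
          (∃ c : G.ConnectedComponent,
            Nonempty (c.toSimpleGraph ≃g CHHGraph.matchingComplement n)) ∧
          ∀ c : G.ConnectedComponent,
            Nonempty (c.toSimpleGraph ≃g CHHGraph.matchingComplement n) ∨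
            (CHHGraph.PartsHaveCommonNeighbour c.toSimpleGraph ∧
              CHHGraph.IsPCMFree n c.toSimpleGraph))) := by
  classical
  constructor
  · intro hG
    have hE := CHHGraph.isCHH_iff_extends_components.1 hG
    refine ⟨fun c => CHHGraph.isCHH_iff_extends_self.2 (hE c c), ?_⟩
    by_cases hnt : ∀ c : G.ConnectedComponent, Nontrivial c
    swap
    · push Not at hnt
      obtain ⟨c, hc⟩ := hnt
      exact Or.inl (CHHGraph.eq_bot_of_subsingleton hE (c := c)
        (not_nontrivial_iff_subsingleton.2 hc))
    right
    by_cases hcol : ∀ c : G.ConnectedComponent, ∃ col, CHHGraph.IsTwoColouring c.toSimpleGraph col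
    swap
    · push Not at hcol
      obtain ⟨c, hc⟩ := hcol
      exact Or.inl (CHHGraph.exists_forall_isTreelike hE hnt hc)
    right
    by_cases hsq : ∀ c : G.ConnectedComponent, CHHGraph.AllInducedCyclesSquares c.toSimpleGraph ∧
        ¬ CHHGraph.twoSquares.IsIndContained c.toSimpleGraph
    · exact Or.inl fun c => ⟨hnt c, hsq c⟩
    right
    push Not at hsq
    obtain ⟨c₀, hc₀⟩ := hsq
    obtain ⟨col₀, hcol₀⟩ := hcol c₀
    -- The one bad component `c₀` is the source of the extension problems, so its long cycle or
    -- two-squares graph constrains every component.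
    have hdich : ∀ c : G.ConnectedComponent, CHHGraph.PartsHaveCommonNeighbour c.toSimpleGraph ∨
        ∃ m, 3 ≤ m ∧ Nonempty (c.toSimpleGraph ≃g CHHGraph.matchingComplement m) := by
      intro c
      obtain ⟨col, hcol⟩ := hcol c
      have : Nontrivial c := hnt c
      exact CHHGraph.partsHaveCommonNeighbour_or_iso (hE c c) c.connected_toSimpleGraph hcol
        fun a b p hp => (hE c₀ c).exists_common_adj_of_not_squares hcol₀ hc₀ p hp
    by_cases hcn : ∀ c : G.ConnectedComponent, CHHGraph.PartsHaveCommonNeighbour c.toSimpleGraph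
    · exact Or.inl hcn
    right
    push Not at hcn
    obtain ⟨c₁, hc₁⟩ := hcn
    obtain ⟨n, hn, ⟨e₁⟩⟩ := (hdich c₁).resolve_left hc₁
    refine ⟨n, hn, ⟨c₁, ⟨e₁⟩⟩, fun c => ?_⟩
    rcases hdich c with hc | ⟨m, hm, ⟨e⟩⟩
    · obtain ⟨col, hcol, hcn⟩ := CHHGraph.partsHaveCommonNeighbour_iff.1 hc
      refine Or.inr ⟨hc, CHHGraph.not_isPCM_of_extends ((hE c c₁).congr_right e₁) hcol ?_⟩
      intro p Y hY _
      obtain ⟨w, hw⟩ := hcn p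
      exact ⟨w, fun y hy => hw y (hY y hy)⟩
    · left
      -- Extending in both directions between two crowns forces equal sizes.
      have h1 := CHHGraph.le_of_extends_matchingComplement e c.connected_toSimpleGraph
        ((hE c c₁).congr_right e₁) hn
      have h2 := CHHGraph.le_of_extends_matchingComplement e₁ c₁.connected_toSimpleGraph
        ((hE c₁ c).congr_right e) hm
      obtain rfl : m = n := le_antisymm h1 h2
      exact ⟨e⟩
  · rintro ⟨hself, hcases⟩
    rw [CHHGraph.isCHH_iff_extends_components]
    have hne : ∀ c : G.ConnectedComponent, Nonempty c := fun c =>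
      c.connected_toSimpleGraph.nonempty
    rcases hcases with rfl | ⟨n, -, hn⟩ | hsq | hcn | ⟨n, hn, -, hc⟩
    · intro c d
      have := hne d
      exact CHHGraph.extends_of_exists_hom fun A hA φ hφ =>
        ⟨⟨φ, fun {a b} hab => (SimpleGraph.bot_adj _ _ |>.1 hab).elim⟩, fun _ _ => rfl⟩
    · exact fun c d => (hn c).extends (hn d)
    · intro c d
      have := (hsq d).1
      exact CHHGraph.extends_of_squares c.connected_toSimpleGraph (hsq c).2.1 (hsq c).2.2
        d.connected_toSimpleGraph
    · intro c d
      obtain ⟨col, hcol, -⟩ := CHHGraph.partsHaveCommonNeighbour_iff.1 (hcn c)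
      exact CHHGraph.extends_of_partsHaveCommonNeighbour c.connected_toSimpleGraph hcol (hcn d)
    · intro c d
      have hcol : ∃ col, CHHGraph.IsTwoColouring c.toSimpleGraph col := by
        rcases hc c with ⟨⟨e⟩⟩ | ⟨h, -⟩
        · exact ⟨_, (CHHGraph.isTwoColouring_matchingComplement n).comp_hom e.toHom⟩
        · obtain ⟨col, hcol, -⟩ := CHHGraph.partsHaveCommonNeighbour_iff.1 h
          exact ⟨col, hcol⟩
      obtain ⟨col, hcol⟩ := hcol
      rcases hc d with ⟨⟨e⟩⟩ | ⟨h, -⟩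
      · rcases hc c with ⟨⟨e'⟩⟩ | ⟨-, hfree⟩
        -- Two copies of the same crown: the C-HH property of `c` is transported along the
        -- isomorphism.
        · exact (CHHGraph.isCHH_iff_extends_self.1 (hself c)).congr_right (e'.trans e.symm)
        · exact (CHHGraph.extends_matchingComplement c.connected_toSimpleGraph hcol hfree
            hn).congr_right e.symm
      · exact CHHGraph.extends_of_partsHaveCommonNeighbour c.connected_toSimpleGraph hcol h
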